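/- Let $p$ be a prime and $n \ge 5$, and let $V = \mathbb{F}_p^n$ and $W = \mathbb{F}_p^{n-3}$. For an alternating bilinear map $B \colon V \times V \to W$ and a subspace $H \le V$, let $B(H,H) \le W$ denote the span of $\{B(x,y) : x, y \in H\}$; call $H$ totally isotropic if $B(H,H) = 0$, and call a proper subspace $H < V$ bad (for $B$) if $$\dim W / B(H,H) \ \ge\ \dim V / H .$$ Let $B$ be chosen uniformly at random from the finite set of all alternating bilinear maps $V \times V \to W$. Put $$\lambda_p = (1-p^{-1})^{-1}(1-p^{-2})^{-1}(1-p^{-3})^{-1}.$$ Then: 1. The expected number of bad subspaces of dimension at least $4$ tends to $0$ as either $n$ or $p$ tends to infinity; that is, for every $\varepsilon > 0$ there is $C$ such that this expectation is less than $\varepsilon$ for all primes $p$ and all $n \ge 5$ with $\max(n,p) \ge C$. 2. A $3$-dimensional subspace is bad if and only if it is totally isotropic; and for each fixed $p$, as $n \to \infty$, the number of bad (i.e., totally isotropic) $3$-dimensional subspaces converges in distribution to a Poisson random variable with parameter $\lambda_p$. 3. The probability that there is no bad subspace is positive provided that either $\min(p,n) \ge 12$ or $n \ge 160$, and for each fixed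 $p$ it tends to $\exp(-\lambda_p)$ as $n \to \infty$. -/

import Mathlib

open MeasureTheory ProbabilityTheory Filter Topology

namespace BadSubspaces

section Bilinear

/-- The space `Alt(V, W)` of alternating bilinear maps `B : V × V → W`, i.e. `B(x, x) = 0`
for all `x` (every subspace of dimension at most one is totally isotropic). -/
def Alt (K V W : Type*) [Field K] [AddCommGroup V] [Module K V] [AddCommGroup W] [Module K W] :
    Submodule K (V →ₗ[K] V →ₗ[K] W) where
  carrier := {B | B.IsAlt}
  zero_mem' := fun _ => rfl
  add_mem' := by
    intro A B hA hB x
    simp [hA x, hB x]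
  smul_mem' := by
    intro c B hB x
    simp [hB x]

/-- `H` is totally isotropic for `B`: the span `B(H, H)` of the image of `B` on `H × H` is zero. -/
def TotallyIsotropic {K V W : Type*} [Field K] [AddCommGroup V] [Module K V]
    [AddCommGroup W] [Module K W] (B : V →ₗ[K] V →ₗ[K] W) (H : Submodule K V) : Prop :=
  Submodule.map₂ B H H = ⊥

/-- A proper subspace `H < V` is bad for `B` if `dim W / B(H, H) ≥ dim V / H`, where
`B(H, H)` is the span of the image of `B` on `H × H`. -/
def IsBad {K V W : Type*} [Field K] [AddCommGroup V] [Module K V]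
    [AddCommGroup W] [Module K W] (B : V →ₗ[K] V →ₗ[K] W) (H : Submodule K V) : Prop :=
  H < ⊤ ∧ Module.finrank K (W ⧸ Submodule.map₂ B H H) ≥ Module.finrank K (V ⧸ H)

end Bilinear

section Random

/-- The sample space `Alt(𝔽_p^n, 𝔽_p^(n-3))`. -/
abbrev Sample (p n : ℕ) [Fact p.Prime] : Type :=
  Alt (ZMod p) (Fin n → ZMod p) (Fin (n - 3) → ZMod p)

instance (p n : ℕ) [Fact p.Prime] : Finite (Sample p n) :=
  have : Finite ((Fin n → ZMod p) →ₗ[ZMod p] (Fin (n - 3) → ZMod p)) :=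
    DFunLike.finite _
  have : Finite ((Fin n → ZMod p) →ₗ[ZMod p] (Fin n → ZMod p) →ₗ[ZMod p]
      (Fin (n - 3) → ZMod p)) := DFunLike.finite _
  Subtype.finite

/-- Every set of alternating maps is an event. -/
instance (p n : ℕ) [Fact p.Prime] : MeasurableSpace (Sample p n) := ⊤

instance (p n : ℕ) [Fact p.Prime] : DiscreteMeasurableSpace (Sample p n) := ⟨fun _ => trivial⟩

/-- The uniform distribution on `Alt(𝔽_p^n, 𝔽_p^(n-3))`. -/
noncomputable def unif (p n : ℕ) [Fact p.Prime] : Measure (Sample p n) :=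
  uniformOn Set.univ

instance (p n : ℕ) [Fact p.Prime] : IsProbabilityMeasure (unif p n) :=
  isProbabilityMeasure_uniformOn Set.finite_univ Set.univ_nonempty

/-- The number of bad subspaces of dimension exactly `h`. -/
noncomputable def numBad (p n h : ℕ) [Fact p.Prime] (B : Sample p n) : ℕ :=
  {H : Submodule (ZMod p) (Fin n → ZMod p) |
    IsBad B.1 H ∧ Module.finrank (ZMod p) H = h}.ncard

/-- The number of bad subspaces of dimension at least `h`. -/
noncomputable def numBadGE (p n h : ℕ) [Fact p.Prime] (B : Sample p n) : ℕ :=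
  {H : Submodule (ZMod p) (Fin n → ZMod p) |
    IsBad B.1 H ∧ h ≤ Module.finrank (ZMod p) H}.ncard

/-- The event that there is no bad subspace. -/
def noBad (p n : ℕ) [Fact p.Prime] : Set (Sample p n) :=
  {B | ∀ H : Submodule (ZMod p) (Fin n → ZMod p), ¬ IsBad B.1 H}

/-- `λ_p = ∏_{i=1}^{3} (1 - p^{-i})⁻¹`. -/
noncomputable def rate (p : ℕ) : ℝ :=
  ∏ i ∈ Finset.Icc (1 : ℕ) 3, (1 - ((p : ℝ) ^ i)⁻¹)⁻¹

end Random

end BadSubspaces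

/-! Put m = n - 3. In coordinates on W a uniform B is a list of m independent uniform alternating
forms, so given subspaces are all totally isotropic with probability p^(-mc), where c is the
codimension of the space of forms vanishing on each of them.

In dimension at least 4 a first-moment bound suffices. If H is bad of dimension g + 3, then B(H, H)
lies in some g-dimensional U ≤ W. Counting the pairs (H, U) bounds the expectation by 16 p^(-(n-4))
for each of the n - 4 possible dimensions (`sum_ncard_isBad_le`).

Bad 3-spaces are counted through factorial moments. The k-th one sums the above probability over
ordered k-tuples of distinct 3-spaces. Tuples with direct sum have c = 3k, and there are about λ_p^k
p^(3km) of them, so they contribute λ_p^k in the limit. A tuple whose sum has dimension d < 3k is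
one of O(p^(dn)), so c ≥ d alone would leave a contribution that need not vanish. The crux is
`finrank_inf_vanishing_add_finrank_sup_lt`, which gives c ≥ d + 1 and makes this part O(p^(-n)) for
fixed k. Hence every factorial moment tends to λ_p^k (`tendsto_moment`).

Bonferroni inequalities turn this into convergence of point probabilities
(`tendsto_of_factorialMoments`), hence into Poisson convergence. Positivity for explicit n and p
uses an even truncation with explicit error terms: ten terms when p < 13 and four when p ≥ 13. -/

namespace BadSubspaces

/-! ### Module structure on the space of alternating maps. -/

section Instances

variable {K V W : Type*} [Field K] [AddCommGroup V] [Module K V] [AddCommGroup W] [Module K W]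

instance instAddCommGroupAlt : AddCommGroup (Alt K V W) := Submodule.addCommGroup _

instance instModuleAlt : Module K (Alt K V W) := Submodule.module _

instance instFiniteAlt [FiniteDimensional K V] [FiniteDimensional K W] :
    FiniteDimensional K (Alt K V W) :=
  inferInstance

end Instances

/-! ### Conditions imposed on an alternating form by isotropy of one more subspace. -/

section Forms

variable {K V : Type*} [Field K] [AddCommGroup V] [Module K V]

/-- The alternating form `φ ∧ ψ`. -/
def wedge (φ ψ : Module.Dual K V) : Alt K V K :=
  ⟨φ.smulRight ψ - ψ.smulRight φ, fun x => by simp [mul_comm]⟩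

lemma wedge_apply (φ ψ : Module.Dual K V) (x y : V) :
    (wedge φ ψ).1 x y = φ x * ψ y - ψ x * φ y := by
  simp [wedge]

/-- The alternating forms for which `H` is totally isotropic. -/
def vanishing (H : Submodule K V) : Submodule K (Alt K V K) where
  carrier := {b | ∀ x ∈ H, ∀ y ∈ H, b.1 x y = 0}
  zero_mem' := fun _ _ _ _ => rfl
  add_mem' := by
    intro a b ha hb x hx y hy
    simp [ha x hx y hy, hb x hx y hy]
  smul_mem' := by
    intro c b hb x hx y hy
    simp [hb x hx y hy]

lemma mem_vanishing {H : Submodule K V} {b : Alt K V K} :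
    b ∈ vanishing H ↔ ∀ x ∈ H, ∀ y ∈ H, b.1 x y = 0 := Iff.rfl

lemma vanishing_anti {H H' : Submodule K V} (h : H ≤ H') : vanishing H' ≤ vanishing H :=
  fun _ hb x hx y hy => hb x (h hx) y (h hy)

lemma vanishing_sup_le (S : Finset (Submodule K V)) :
    vanishing (S.sup id) ≤ S.inf vanishing :=
  Finset.le_inf fun _ hH => vanishing_anti (Finset.le_sup (f := id) hH)

lemma exists_dual_family {ι : Type*} [DecidableEq ι] {v : ι → V} (hv : LinearIndependent K v) :
    ∃ φ : ι → Module.Dual K V, ∀ i j, φ i (v j) = if i = j then 1 else 0 := by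
  obtain ⟨g, hg⟩ := (Finsupp.linearCombination K v).exists_leftInverse_of_injective
    (LinearMap.ker_eq_bot.2 hv)
  refine ⟨fun i => Finsupp.lapply i ∘ₗ g, fun i j => ?_⟩
  have : g (v j) = Finsupp.single j 1 := by
    have := LinearMap.congr_fun hg (Finsupp.single j 1)
    simpa using this
  simp [this, Finsupp.single_apply, eq_comm]

lemma finrank_add_card_le {M P : Type*} [AddCommGroup M] [Module K M] [FiniteDimensional K M]
    [Fintype P] [DecidableEq P] (L : M →ₗ[K] P → K) {A B : Submodule K M} (hBA : B ≤ A)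
    (hB : B ≤ LinearMap.ker L) (hA : ∀ p, ∃ a ∈ A, L a = Pi.single p 1) :
    Module.finrank K B + Fintype.card P ≤ Module.finrank K A := by
  have hsurj : LinearMap.range (L.domRestrict A) = ⊤ := by
    rw [eq_top_iff, ← (Pi.basisFun K P).span_eq, Submodule.span_le]
    rintro _ ⟨p, rfl⟩
    obtain ⟨a, ha, h⟩ := hA p
    exact ⟨⟨a, ha⟩, by simp [h]⟩
  have h1 := (L.domRestrict A).finrank_range_add_finrank_ker
  rw [hsurj, finrank_top, Module.finrank_fintype_fun_eq_card] at h1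
  have h2 : Module.finrank K B ≤ Module.finrank K (LinearMap.ker (L.domRestrict A)) := by
    rw [← LinearEquiv.finrank_eq (Submodule.submoduleOfEquivOfLe hBA)]
    refine Submodule.finrank_mono fun x hx => ?_
    exact hB hx
  omega

lemma finrank_le_finrank_inf_ker_add {M P : Type*} [AddCommGroup M] [Module K M]
    [FiniteDimensional K M] [Fintype P] (L : M →ₗ[K] P → K) (A : Submodule K M) :
    Module.finrank K A ≤
      Module.finrank K (A ⊓ LinearMap.ker L : Submodule K M) + Fintype.card P := by
  have h1 := (L.domRestrict A).finrank_range_add_finrank_ker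
  have h2 := Submodule.finrank_le (LinearMap.range (L.domRestrict A))
  rw [Module.finrank_fintype_fun_eq_card] at h2
  have h3 : Module.finrank K (LinearMap.ker (L.domRestrict A)) ≤
      Module.finrank K (A ⊓ LinearMap.ker L : Submodule K M) := by
    rw [LinearEquiv.finrank_eq (Submodule.equivMapOfInjective A.subtype A.subtype_injective
      (LinearMap.ker (L.domRestrict A)))]
    refine Submodule.finrank_mono ?_
    rintro _ ⟨b, hb, rfl⟩
    exact ⟨b.2, hb⟩
  omega

variable [FiniteDimensional K V]

/-- A basis of D ∩ H is extended to one of H. The new vectors stay independent modulo D, so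
functionals ψ dual to them can be pulled back from V / D; a wedge with such a factor vanishes on D ×
D. -/
lemma exists_adapted_family (D H : Submodule K V) {e f : ℕ}
    (he : Module.finrank K (D ⊓ H : Submodule K V) = e) (hf : Module.finrank K H = e + f) :
    ∃ (v : Fin e ⊕ Fin f → V) (φ : Fin e ⊕ Fin f → Module.Dual K V)
      (ψ : Fin f → Module.Dual K V), (∀ i, v i ∈ H) ∧
      (∀ i j, φ i (v j) = if i = j then 1 else 0) ∧
      (∀ i j, ψ i (v j) = if Sum.inr i = j then 1 else 0) ∧ ∀ i, ∀ x ∈ D, ψ i x = 0 := by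
  classical
  obtain ⟨C, hC, hCH⟩ : ∃ C : Submodule K V, (D ⊓ H) ⊓ C = ⊥ ∧ (D ⊓ H) ⊔ C = H := by
    obtain ⟨C, hC⟩ := ComplementedLattice.exists_isCompl ((D ⊓ H).submoduleOf H)
    have hmap : ((D ⊓ H).submoduleOf H).map H.subtype = D ⊓ H := by
      rw [Submodule.submoduleOf, Submodule.map_comap_subtype]
      exact inf_eq_right.2 inf_le_right
    refine ⟨C.map H.subtype, ?_, ?_⟩
    · rw [← hmap, ← Submodule.map_inf _ H.subtype_injective, hC.inf_eq_bot, Submodule.map_bot]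
    · conv_lhs => rw [← hmap]
      rw [← Submodule.map_sup, hC.sup_eq_top, Submodule.map_top, Submodule.range_subtype]
  have hCle : C ≤ H := hCH ▸ le_sup_right
  have hDC : D ⊓ C = ⊥ := by
    rw [← hC]
    refine le_antisymm (le_inf (le_inf inf_le_left (inf_le_right.trans hCle)) inf_le_right) ?_
    exact inf_le_inf_right _ inf_le_left
  have hfC : Module.finrank K C = f := by
    have := Submodule.finrank_sup_add_finrank_inf_eq (D ⊓ H) C
    rw [hC, hCH, finrank_bot, he, hf] at this
    omega
  obtain ⟨c⟩ : Nonempty (Module.Basis (Fin e) K (D ⊓ H : Submodule K V)) :=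
    ⟨Module.finBasisOfFinrankEq K _ he⟩
  obtain ⟨d⟩ : Nonempty (Module.Basis (Fin f) K C) := ⟨Module.finBasisOfFinrankEq K _ hfC⟩
  let v : Fin e ⊕ Fin f → V := Sum.elim (fun i => (c i : V)) (fun j => (d j : V))
  have hc : LinearIndependent K fun i => (c i : V) :=
    c.linearIndependent.map' (D ⊓ H).subtype (D ⊓ H).ker_subtype
  have hd : LinearIndependent K fun i => (d i : V) :=
    d.linearIndependent.map' C.subtype C.ker_subtype
  have hv : LinearIndependent K v := by
    refine hc.sum_type hd ?_
    refine (disjoint_iff.2 hC).mono ?_ ?_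
    · exact Submodule.span_le.2 (Set.range_subset_iff.2 fun i => (c i).2)
    · exact Submodule.span_le.2 (Set.range_subset_iff.2 fun i => (d i).2)
  have hw : LinearIndependent K (fun j => D.mkQ (d j : V)) := by
    have : LinearMap.ker (D.mkQ ∘ₗ C.subtype) = ⊥ := by
      rw [eq_bot_iff]
      intro x hx
      have hxD : (x : V) ∈ D := by simpa using hx
      have : (x : V) ∈ D ⊓ C := ⟨hxD, x.2⟩
      rw [hDC] at this
      simpa using this
    exact d.linearIndependent.map' _ this
  obtain ⟨φ, hφ⟩ := exists_dual_family hv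
  obtain ⟨χ, hχ⟩ := exists_dual_family hw
  refine ⟨v, φ, fun j => χ j ∘ₗ D.mkQ, ?_, hφ, ?_, ?_⟩
  · rintro (i | j)
    · exact (c i).2.2
    · exact hCle (d j).2
  · rintro i (j | j)
    · have : D.mkQ (c j : V) = 0 := by simpa using (c j).2.1
      simp only [v, Sum.elim_inl, LinearMap.comp_apply, this]
      simp
    · simpa [v] using hχ i j
  · intro i x hx
    have : D.mkQ x = 0 := by simpa using hx
    simp only [LinearMap.comp_apply, this, map_zero]

/-- Passing from a space `A` of forms that contains all forms vanishing on `D` to those that vanish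
on `H` too costs at least `dim Λ²H - dim Λ²(D ∩ H)` dimensions. -/
lemma finrank_inf_vanishing_add_le (D H : Submodule K V) {A : Submodule K (Alt K V K)} {e f : ℕ}
    (hA : vanishing D ≤ A) (he : Module.finrank K (D ⊓ H : Submodule K V) = e)
    (hf : Module.finrank K H = e + f) :
    Module.finrank K (A ⊓ vanishing H : Submodule K (Alt K V K)) + (f * e + f.choose 2) ≤
      Module.finrank K A := by
  classical
  obtain ⟨v, φ, ψ, hvH, hφ, hψ, hψD⟩ := exists_adapted_family D H he hf
  -- `P` indexes pairs consisting of a new basis vector of H and an earlier basis vector, Σ (e + j)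
  -- in all. The wedges φ ∧ ψ attached to these pairs vanish on D and are dual to the evaluations at
  -- the pairs.
  let P := Σ j : Fin f, Fin e ⊕ Fin j
  let u : P → Fin e ⊕ Fin f := fun p => p.2.map id (Fin.castLE p.1.2.le)
  let L : Alt K V K →ₗ[K] P → K :=
    { toFun := fun b p => b.1 (v (u p)) (v (Sum.inr p.1))
      map_add' := fun a b => by ext p; simp
      map_smul' := fun a b => by ext p; simp }
  have hcard : Fintype.card P = f * e + f.choose 2 := by
    simp only [P, Fintype.card_sigma, Fintype.card_sum, Fintype.card_fin, Finset.sum_add_distrib]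
    rw [Fin.sum_univ_eq_sum_range (fun i => i) f, Finset.sum_range_id, Nat.choose_two_right]
    simp
  rw [← hcard]
  refine finrank_add_card_le L inf_le_left ?_ ?_
  · intro b hb
    ext p
    exact hb.2 _ (hvH _) _ (hvH _)
  · rintro p
    refine ⟨wedge (φ (u p)) (ψ p.1), hA ?_, ?_⟩
    · intro x hx y hy
      simp [wedge_apply, hψD p.1 x hx, hψD p.1 y hy]
    · ext r
      change (wedge (φ (u p)) (ψ p.1)).1 (v (u r)) (v (Sum.inr r.1)) = _
      rw [wedge_apply, hφ, hφ, hψ, hψ, Pi.single_apply]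
      obtain ⟨j, a⟩ := p
      obtain ⟨l, b⟩ := r
      have h2 : ¬ (Sum.inr j = u ⟨l, b⟩ ∧ u ⟨j, a⟩ = Sum.inr l) := by
        rintro ⟨h, h'⟩
        rcases a with a | a <;> rcases b with b | b <;>
          simp [u, Fin.ext_iff] at h h'
        omega
      have h1 : (u ⟨j, a⟩ = u ⟨l, b⟩ ∧ j = l) ↔ (⟨l, b⟩ : P) = ⟨j, a⟩ := by
        constructor
        · rintro ⟨h, rfl⟩
          rcases a with a | a <;> rcases b with b | b <;> simp [u, Fin.ext_iff] at h ⊢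
          · exact h.symm
          · exact h.symm
        · rintro h
          cases h
          exact ⟨rfl, rfl⟩
      have h3 : (Sum.inr j : Fin e ⊕ Fin f) = Sum.inr l ↔ j = l := by simp
      simp only [h3, ← h1]
      by_cases c1 : u ⟨j, a⟩ = u ⟨l, b⟩ <;> by_cases c2 : j = l <;>
        by_cases c3 : Sum.inr j = u ⟨l, b⟩ <;> by_cases c4 : u ⟨j, a⟩ = Sum.inr l <;>
        simp_all

lemma finrank_vanishing_add_le (H : Submodule K V) :
    Module.finrank K (vanishing H) + (Module.finrank K H).choose 2 ≤
      Module.finrank K (Alt K V K) := by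
  have := finrank_inf_vanishing_add_le ⊥ H (A := ⊤) le_top
    (e := 0) (by rw [bot_inf_eq, finrank_bot]) (zero_add _).symm
  rw [top_inf_eq, finrank_top] at this
  simpa using this

/-- On a 3-dimensional space an alternating form is determined by three values, here taken at the
cyclic pairs of a basis, with `i + 1` computed in `Fin 3`. -/
lemma finrank_le_finrank_inf_vanishing_add (A : Submodule K (Alt K V K)) {H : Submodule K V}
    (hH : Module.finrank K H = 3) :
    Module.finrank K A ≤ Module.finrank K (A ⊓ vanishing H : Submodule K (Alt K V K)) + 3 := by
  obtain ⟨c⟩ : Nonempty (Module.Basis (Fin 3) K H) := ⟨Module.finBasisOfFinrankEq K _ hH⟩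
  let L : Alt K V K →ₗ[K] Fin 3 → K :=
    { toFun := fun b i => b.1 (c i) (c (i + 1))
      map_add' := fun a b => by ext p; simp
      map_smul' := fun a b => by ext p; simp }
  refine (finrank_le_finrank_inf_ker_add L A).trans ?_
  rw [Fintype.card_fin]
  refine Nat.add_le_add_right (Submodule.finrank_mono (inf_le_inf_left _ fun b hb => ?_)) 3
  have hz : ∀ i, b.1 (c i) (c (i + 1)) = 0 := fun i => congrFun hb i
  have hb' : (b.1.domRestrict₁₂ H H) = 0 := by
    refine LinearMap.ext_basis c c fun i j => ?_
    have halt : b.1.IsAlt := b.2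
    have hij : j = i ∨ j = i + 1 ∨ i = j + 1 := by revert i j; decide
    rcases hij with rfl | rfl | rfl
    · exact halt _
    · exact hz i
    · change b.1 (c (j + 1)) (c j) = 0
      rw [← halt.neg, hz j, neg_zero]
  intro x hx y hy
  exact LinearMap.congr_fun (LinearMap.congr_fun hb' ⟨x, hx⟩) ⟨y, hy⟩

end Forms

/-! ### Codimension of the forms vanishing on a family of 3-spaces. -/

section Families

variable {K V : Type*} [Field K] [AddCommGroup V] [Module K V] [FiniteDimensional K V]

/-- Take φ₀ killing P but not x₀ ∈ H, and ψ₀ killing Q but not y₀ ∈ H. Since dim H ≥ 3, some nonzero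
z ∈ H is killed by both. If all such wedges vanished on H, testing them on (z, y₀) would put z in P
and testing on (x₀, z) would put z in Q, contradicting P ∩ Q = 0. -/
lemma exists_wedge_ne_zero {P Q H : Submodule K V} (hPQ : P ⊓ Q = ⊥) (hHP : ¬ H ≤ P)
    (hHQ : ¬ H ≤ Q) (hH : 3 ≤ Module.finrank K H) :
    ∃ φ ψ : Module.Dual K V, (∀ x ∈ P, φ x = 0) ∧ (∀ x ∈ Q, ψ x = 0) ∧
      ∃ x ∈ H, ∃ y ∈ H, (wedge φ ψ).1 x y ≠ 0 := by
  have sep : ∀ (S : Submodule K V) (x : V), x ∉ S →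
      ∃ φ : Module.Dual K V, (∀ y ∈ S, φ y = 0) ∧ φ x ≠ 0 := by
    intro S x hx
    obtain ⟨f, hf, h⟩ := Submodule.exists_le_ker_of_notMem hx
    exact ⟨f, fun y hy => h hy, hf⟩
  obtain ⟨x₀, hx₀, hx₀P⟩ := SetLike.not_le_iff_exists.1 hHP
  obtain ⟨y₀, hy₀, hy₀Q⟩ := SetLike.not_le_iff_exists.1 hHQ
  obtain ⟨φ₀, hφ₀, hφx⟩ := sep P x₀ hx₀P
  obtain ⟨ψ₀, hψ₀, hψy⟩ := sep Q y₀ hy₀Q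
  obtain ⟨z, hz, hz0⟩ : ∃ z : H, φ₀ z = 0 ∧ ψ₀ z = 0 ∧ z ≠ 0 := by
    have : LinearMap.ker ((φ₀.prod ψ₀).domRestrict H) ≠ ⊥ := by
      refine LinearMap.ker_ne_bot_of_finrank_lt ?_
      simp
      omega
    obtain ⟨z, hz, h0⟩ := Submodule.exists_mem_ne_zero_of_ne_bot this
    have : φ₀ z = 0 ∧ ψ₀ z = 0 := by simpa using hz
    exact ⟨z, this.1, this.2, h0⟩
  by_contra! hcon
  refine hz0.2 ?_
  have hzP : (z : V) ∈ P := by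
    by_contra hzP
    obtain ⟨φ, hφ, h⟩ := sep P z hzP
    have := hcon φ ψ₀ hφ hψ₀ z z.2 y₀ hy₀
    simp [wedge_apply, hz0.1, h, hψy] at this
  have hzQ : (z : V) ∈ Q := by
    by_contra hzQ
    obtain ⟨ψ, hψ, h⟩ := sep Q z hzQ
    have := hcon φ₀ ψ hφ₀ hψ x₀ hx₀ z z.2
    simp [wedge_apply, hz, h, hφx] at this
  have : (z : V) ∈ P ⊓ Q := ⟨hzP, hzQ⟩
  rw [hPQ] at this
  simpa using this

variable [DecidableEq (Submodule K V)]

lemma exists_finrank_insert {S : Finset (Submodule K V)} {H : Submodule K V}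
    (hH : Module.finrank K H = 3) : ∃ e f : ℕ, e + f = 3 ∧
      Module.finrank K (S.sup id ⊓ H : Submodule K V) = e ∧
      Module.finrank K ((insert H S).inf vanishing : Submodule K (Alt K V K)) +
        (f * e + f.choose 2) ≤ Module.finrank K (S.inf vanishing : Submodule K (Alt K V K)) ∧
      Module.finrank K ((insert H S).sup id : Submodule K V) =
        Module.finrank K (S.sup id : Submodule K V) + f := by
  have he : Module.finrank K (S.sup id ⊓ H : Submodule K V) ≤ 3 :=
    hH ▸ Submodule.finrank_mono inf_le_right
  obtain ⟨f, hf⟩ := Nat.exists_eq_add_of_le he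
  refine ⟨_, f, hf.symm, rfl, ?_, ?_⟩
  · rw [Finset.inf_insert, inf_comm]
    exact finrank_inf_vanishing_add_le _ H (vanishing_sup_le S) rfl (hH.trans hf)
  · have := Submodule.finrank_sup_add_finrank_inf_eq (S.sup id) H
    rw [Finset.sup_insert, id_eq, sup_comm]
    omega

/-- If H enlarges the sum by f, it costs at least f(3 - f) + f(f - 1)/2 conditions, that is 0, 2, 3,
3 for f = 0, 1, 2, 3. This is never below f, and exceeds f for f = 1, 2. -/
lemma finrank_inf_vanishing_add_insert_le {S : Finset (Submodule K V)} {H : Submodule K V}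
    (hH : Module.finrank K H = 3) :
    Module.finrank K ((insert H S).inf vanishing : Submodule K (Alt K V K)) +
        Module.finrank K ((insert H S).sup id : Submodule K V) ≤
      Module.finrank K (S.inf vanishing : Submodule K (Alt K V K)) +
        Module.finrank K (S.sup id : Submodule K V) := by
  obtain ⟨e, f, hef, -, h1, h2⟩ := exists_finrank_insert (S := S) hH
  have : f ≤ 3 := by omega
  obtain rfl : e = 3 - f := by omega
  interval_cases f <;> simp [Nat.choose] at h1 h2 <;> omega

lemma finrank_inf_vanishing_add_finrank_sup_le (S : Finset (Submodule K V))
    (hS : ∀ H ∈ S, Module.finrank K H = 3) :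
    Module.finrank K (S.inf vanishing : Submodule K (Alt K V K)) +
      Module.finrank K (S.sup id : Submodule K V) ≤ Module.finrank K (Alt K V K) := by
  induction S using Finset.induction_on with
  | empty => rw [Finset.inf_empty, Finset.sup_empty, finrank_bot, finrank_top, add_zero]
  | insert H S _ ih =>
    exact (finrank_inf_vanishing_add_insert_le (hS H (by simp))).trans
      (ih fun H' h' => hS H' (by simp [h']))

lemma finrank_sup_le (S : Finset (Submodule K V)) (hS : ∀ H ∈ S, Module.finrank K H = 3) :
    Module.finrank K (S.sup id : Submodule K V) ≤ 3 * S.card := by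
  induction S using Finset.induction_on with
  | empty => simp
  | insert H S hH ih =>
    have h1 := ih fun H' h' => hS H' (by simp [h'])
    obtain ⟨e, f, hef, -, -, h2⟩ := exists_finrank_insert (S := S) (hS H (by simp))
    rw [Finset.card_insert_of_notMem hH]
    omega

/-- Distinct three-dimensional subspaces that are not independent impose more conditions on a form
than the dimension of their sum. -/
lemma finrank_inf_vanishing_add_finrank_sup_lt (S : Finset (Submodule K V))
    (hS : ∀ H ∈ S, Module.finrank K H = 3)
    (hd : Module.finrank K (S.sup id : Submodule K V) ≠ 3 * S.card) :
    Module.finrank K (S.inf vanishing : Submodule K (Alt K V K)) +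
      Module.finrank K (S.sup id : Submodule K V) < Module.finrank K (Alt K V K) := by
  induction S using Finset.strongInduction with
  | H S ih =>
  have hsub : ∀ H, ∀ H' ∈ S.erase H, Module.finrank K H' = 3 :=
    fun H H' h' => hS H' (Finset.mem_of_mem_erase h')
  -- A strict inequality for a dependent subfamily survives the insertion of H. What remains is a
  -- minimal dependent family: deleting any one member leaves a direct sum.
  by_cases hdep : ∃ H ∈ S, Module.finrank K ((S.erase H).sup id : Submodule K V) ≠
      3 * (S.erase H).card
  · obtain ⟨H, hH, hne⟩ := hdep
    have h1 := ih _ (Finset.erase_ssubset hH) (hsub H) hne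
    have h2 := finrank_inf_vanishing_add_insert_le (S := S.erase H) (hS H hH)
    rw [Finset.insert_erase hH] at h2
    omega
  push Not at hdep
  obtain ⟨H, hH⟩ : S.Nonempty := by
    rw [Finset.nonempty_iff_ne_empty]
    rintro rfl
    simp at hd
  set T := S.erase H with hT
  have hST : insert H T = S := Finset.insert_erase hH
  have hcard : T.card + 1 = S.card := Finset.card_erase_add_one hH
  have hdT := hdep H hH
  have hleT := finrank_inf_vanishing_add_finrank_sup_le T (hsub H)
  obtain ⟨e, f, hef, he, h1, h2⟩ := exists_finrank_insert (S := T) (hS H hH)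
  rw [hST] at h1 h2
  rw [← hT] at hdT
  -- For f = 0 the dimension count gains nothing, so a form vanishing on `T` but not on `H` is
  -- needed. It is a wedge built from the splitting of the sum of `T` into one member `i` and the
  -- sum of the others: `H` lies in neither, by minimality and by distinctness.
  obtain rfl | hf : f = 0 ∨ f ≠ 0 := by omega
  · have hHT : H ≤ T.sup id := by
      have : T.sup id ⊓ H = H := Submodule.eq_of_le_of_finrank_eq inf_le_right (by
        rw [he, hS H hH]; omega)
      exact this ▸ inf_le_left
    obtain ⟨i, hi⟩ : T.Nonempty := by
      rw [Finset.nonempty_iff_ne_empty]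
      intro h0
      rw [h0, Finset.sup_empty, le_bot_iff] at hHT
      have := hS H hH
      rw [hHT, finrank_bot] at this
      omega
    have hiS : i ∈ S := Finset.mem_of_mem_erase hi
    have hiH : i ≠ H := Finset.ne_of_mem_erase hi
    have hTcard : (T.erase i).card + 1 = T.card := Finset.card_erase_add_one hi
    have hP := finrank_sup_le (T.erase i) fun H' h' => hsub H H' (Finset.mem_of_mem_erase h')
    have hsup : (T.erase i).sup id ⊔ i = T.sup id := by
      conv_rhs => rw [← Finset.insert_erase hi, Finset.sup_insert, sup_comm]
      rfl
    have hPQ : (T.erase i).sup id ⊓ i = ⊥ := by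
      have := Submodule.finrank_sup_add_finrank_inf_eq ((T.erase i).sup id) i
      rw [hsup, hdT, hS i hiS] at this
      exact Submodule.finrank_eq_zero.1 (by omega)
    have hHP : ¬ H ≤ (T.erase i).sup id := by
      intro hle
      have h3 := hdep i hiS
      have h4 : insert H (T.erase i) = S.erase i := by
        rw [← hST, Finset.erase_insert_of_ne hiH.symm]
      have h5 := Finset.card_erase_add_one hiS
      rw [← h4, Finset.sup_insert, id_eq, sup_eq_right.2 hle, h4] at h3
      omega
    have hHQ : ¬ H ≤ i := fun hle =>
      hiH (Submodule.eq_of_le_of_finrank_eq hle (by rw [hS H hH, hS i hiS])).symm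
    obtain ⟨φ, ψ, hφ, hψ, x, hx, y, hy, hxy⟩ := exists_wedge_ne_zero hPQ hHP hHQ (hS H hH).ge
    have hmem : wedge φ ψ ∈ T.inf vanishing := by
      rw [Submodule.mem_finsetInf]
      intro j hj x hx y hy
      by_cases hji : j = i
      · subst hji
        simp [wedge_apply, hψ x hx, hψ y hy]
      · have : j ≤ (T.erase i).sup id :=
          Finset.le_sup (f := id) (Finset.mem_erase.2 ⟨hji, hj⟩)
        simp [wedge_apply, hφ x (this hx), hφ y (this hy)]
    have hlt : S.inf vanishing < T.inf vanishing := by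
      refine lt_of_le_of_ne (Finset.inf_mono (Finset.erase_subset _ _)) fun heq => ?_
      rw [← heq, Submodule.mem_finsetInf] at hmem
      exact hxy (hmem H hH x hx y hy)
    have := Submodule.finrank_lt_finrank_of_lt hlt
    omega
  · have : f ≤ 3 := by omega
    obtain rfl : e = 3 - f := by omega
    -- For f = 1, 2 the count is already strict; f = 3 would make the sum of `S` direct, against
    -- `hd`.
    interval_cases f <;> simp [Nat.choose] at h1 h2 hf <;> omega

/-- Independent three-dimensional subspaces impose three conditions each. -/
lemma finrank_inf_vanishing_of_independent (S : Finset (Submodule K V))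
    (hS : ∀ H ∈ S, Module.finrank K H = 3)
    (hd : Module.finrank K (S.sup id : Submodule K V) = 3 * S.card) :
    Module.finrank K (S.inf vanishing : Submodule K (Alt K V K)) + 3 * S.card =
      Module.finrank K (Alt K V K) := by
  refine le_antisymm (hd ▸ finrank_inf_vanishing_add_finrank_sup_le S hS) ?_
  clear hd
  induction S using Finset.induction_on with
  | empty => rw [Finset.inf_empty, finrank_top]; simp
  | insert H S hH ih =>
    have h1 := ih fun H' h' => hS H' (by simp [h'])
    have h2 := finrank_le_finrank_inf_vanishing_add (S.inf vanishing) (hS H (by simp))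
    rw [Finset.inf_insert, Finset.card_insert_of_notMem hH, inf_comm]
    omega

end Families

/-! ### Counting subspaces and direct tuples over a finite field. -/

section Counting

variable {K V : Type*} [Field K] [AddCommGroup V] [Module K V]

/-- The tuples of `d`-dimensional subspaces whose sum is direct. -/
abbrev DirectTuple (K V : Type*) [Field K] [AddCommGroup V] [Module K V] (ι : Type*) [Fintype ι]
    (d : ℕ) : Type _ :=
  {H : ι → Submodule K V // (∀ i, Module.finrank K (H i) = d) ∧
    Module.finrank K (⨆ i, H i : Submodule K V) = Fintype.card ι * d}

lemma iSup_span_range {ι κ : Type*} (v : ι × κ → V) :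
    ⨆ i, Submodule.span K (Set.range fun j => v (i, j)) = Submodule.span K (Set.range v) := by
  rw [← Submodule.span_iUnion]
  congr 1
  ext x
  simp

/-- The tuple of subspaces spanned by the blocks of a linearly independent family. -/
noncomputable def spanTuple {ι : Type*} [Fintype ι] {d : ℕ}
    (v : {v : ι × Fin d → V // LinearIndependent K v}) : DirectTuple K V ι d :=
  ⟨fun i => Submodule.span K (Set.range fun j => v.1 (i, j)), fun i => by
    have : LinearIndependent K fun j => v.1 (i, j) :=
      v.2.comp (fun j => (i, j)) fun a b h => by simpa using h
    simpa using finrank_span_eq_card this, by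
    rw [iSup_span_range, finrank_span_eq_card v.2]
    simp⟩

/-- The families spanning a given direct tuple are the tuples of bases. -/
noncomputable def spanTupleFiberEquiv [FiniteDimensional K V] {ι : Type*} [Fintype ι] {d : ℕ}
    (H : DirectTuple K V ι d) :
    {v : {v : ι × Fin d → V // LinearIndependent K v} // spanTuple v = H} ≃
      ∀ i, {t : Fin d → H.1 i // LinearIndependent K t} where
  toFun v i := ⟨fun j => ⟨v.1.1 (i, j), by
      have : H.1 i = Submodule.span K (Set.range fun j => v.1.1 (i, j)) :=
        congrFun (congrArg Subtype.val v.2.symm) i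
      rw [this]
      exact Submodule.subset_span ⟨j, rfl⟩⟩, by
    refine LinearIndependent.of_comp (H.1 i).subtype ?_
    exact v.1.2.comp (fun j => (i, j)) fun a b h => by simpa using h⟩
  invFun t :=
    have hspan : ∀ i, Submodule.span K (Set.range fun j => ((t i).1 j : V)) = H.1 i := fun i => by
      refine Submodule.eq_of_le_of_finrank_eq
        (Submodule.span_le.2 (Set.range_subset_iff.2 fun j => ((t i).1 j).2)) ?_
      rw [H.2.1 i]
      have : LinearIndependent K fun j => ((t i).1 j : V) :=
        (t i).2.map' (H.1 i).subtype (H.1 i).ker_subtype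
      simpa using finrank_span_eq_card this
    ⟨⟨fun x => (t x.1).1 x.2, by
      rw [linearIndependent_iff_card_eq_finrank_span, Set.finrank, ← iSup_span_range]
      rw [iSup_congr hspan, H.2.2]
      simp⟩, Subtype.ext (funext hspan)⟩
  left_inv v := rfl
  right_inv t := rfl

lemma card_linearIndependent_of_finite [Fintype K] [Finite V] {κ : Type*} [Fintype κ]
    (h : Fintype.card κ ≤ Module.finrank K V) :
    Nat.card {v : κ → V // LinearIndependent K v} =
      ∏ i ∈ Finset.range (Fintype.card κ),
        (Fintype.card K ^ Module.finrank K V - Fintype.card K ^ i) := by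
  rw [Finset.prod_range, ← card_linearIndependent h]
  refine Nat.card_congr ((Equiv.arrowCongr (Fintype.equivFin κ) (Equiv.refl V)).subtypeEquiv ?_)
  intro v
  exact (linearIndependent_equiv (R := K) (Fintype.equivFin κ).symm (f := v)).symm

/-- Linearly independent families are fibred over direct tuples by taking spans of blocks. A fibre
is a choice of basis in each member, so its size is a power of |GL_d|. -/
lemma card_directTuple [Fintype K] [Finite V] {ι : Type*} [Fintype ι] {d : ℕ}
    (h : Fintype.card ι * d ≤ Module.finrank K V) :
    Nat.card (DirectTuple K V ι d) *
        (∏ i ∈ Finset.range d, (Fintype.card K ^ d - Fintype.card K ^ i)) ^ Fintype.card ι =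
      ∏ i ∈ Finset.range (Fintype.card ι * d),
        (Fintype.card K ^ Module.finrank K V - Fintype.card K ^ i) := by
  classical
  have : Finite (DirectTuple K V ι d) := Subtype.finite
  have := Fintype.ofFinite (DirectTuple K V ι d)
  have hcard : Fintype.card (ι × Fin d) = Fintype.card ι * d := by simp
  rw [← hcard, ← card_linearIndependent_of_finite (by rwa [hcard]),
    ← Nat.card_congr (Equiv.sigmaFiberEquiv (spanTuple (K := K) (V := V) (ι := ι) (d := d))),
    Nat.card_sigma]
  have : ∀ H : DirectTuple K V ι d,
      Nat.card {v : {v : ι × Fin d → V // LinearIndependent K v} // spanTuple v = H} =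
      (∏ i ∈ Finset.range d, (Fintype.card K ^ d - Fintype.card K ^ i)) ^ Fintype.card ι := by
    intro H
    rw [Nat.card_congr (spanTupleFiberEquiv H), Nat.card_pi]
    have : ∀ i, Nat.card {t : Fin d → H.1 i // LinearIndependent K t} =
        ∏ i ∈ Finset.range d, (Fintype.card K ^ d - Fintype.card K ^ i) := fun i => by
      rw [card_linearIndependent_of_finite (by simp [H.2.1 i]), H.2.1 i]
      simp
    simp [this]
  simp [this]

/-- The number of `d`-dimensional subspaces. -/
noncomputable def numSubspaces (K V : Type*) [Field K] [AddCommGroup V] [Module K V] (d : ℕ) : ℕ :=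
  Nat.card {H : Submodule K V // Module.finrank K H = d}

lemma numSubspaces_eq_card_directTuple (d : ℕ) :
    numSubspaces K V d = Nat.card (DirectTuple K V Unit d) := by
  refine Nat.card_congr ((Equiv.funUnique Unit (Submodule K V)).symm.subtypeEquiv fun H => ?_)
  change _ ↔ (Unit → Module.finrank K H = d) ∧
    Module.finrank K (⨆ _ : Unit, H : Submodule K V) = Fintype.card Unit * d
  rw [iSup_const, Fintype.card_unit, one_mul]
  exact ⟨fun h => ⟨fun _ => h, h⟩, And.right⟩

/-- `∏_{i=1}^{d} (1 - q^{-i})⁻¹`. -/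
noncomputable def eulerProd (q : ℝ) (d : ℕ) : ℝ :=
  ∏ i ∈ Finset.Icc (1 : ℕ) d, (1 - (q ^ i)⁻¹)⁻¹

lemma rate_eq_eulerProd (p : ℕ) : rate p = eulerProd p 3 := rfl

lemma one_sub_inv_pow_pos {q : ℝ} (hq : 1 < q) {i : ℕ} (hi : i ≠ 0) : 0 < 1 - (q ^ i)⁻¹ :=
  sub_pos.2 (inv_lt_one_of_one_lt₀ (one_lt_pow₀ hq hi))

lemma eulerProd_pos {q : ℝ} (hq : 1 < q) (d : ℕ) : 0 < eulerProd q d :=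
  Finset.prod_pos fun i hi =>
    inv_pos.2 (one_sub_inv_pow_pos hq (by have := Finset.mem_Icc.1 hi; omega))

/-- The product is |GL_d(q)| when q is a prime power; this is how the factor `eulerProd`, and with
it the Poisson rate, enters the counts. -/
lemma prod_pow_sub_pow {q : ℝ} (hq : 1 < q) (d : ℕ) :
    (∏ i ∈ Finset.range d, (q ^ d - q ^ i)) * eulerProd q d = q ^ (d * d) := by
  have h : ∀ i ∈ Finset.range d, q ^ d - q ^ i = q ^ d * (1 - (q ^ (d - 1 - i + 1))⁻¹) := by
    intro i hi
    have hi := Finset.mem_range.1 hi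
    have : d - 1 - i + 1 = d - i := by omega
    rw [this, mul_sub, mul_one, ← pow_sub₀ q (by positivity) (Nat.sub_le d i),
      Nat.sub_sub_self hi.le]
  have h2 : eulerProd q d = ∏ i ∈ Finset.range d, (1 - (q ^ (i + 1))⁻¹)⁻¹ := by
    rw [eulerProd, Finset.range_eq_Ico, Finset.prod_Ico_add' (fun i => (1 - (q ^ i)⁻¹)⁻¹)]
    rfl
  rw [Finset.prod_congr rfl h, Finset.prod_mul_distrib,
    Finset.prod_range_reflect (fun i => 1 - (q ^ (i + 1))⁻¹) d, h2, mul_assoc,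
    ← Finset.prod_mul_distrib, Finset.prod_const, Finset.card_range, ← pow_mul,
    Finset.prod_eq_one, mul_one]
  intro i _
  exact mul_inv_cancel₀ (one_sub_inv_pow_pos hq (Nat.succ_ne_zero i)).ne'

lemma cast_prod_pow_sub_pow {q n d : ℕ} (hq : 0 < q) (hd : d ≤ n) :
    ((∏ i ∈ Finset.range d, (q ^ n - q ^ i) : ℕ) : ℝ) =
      ∏ i ∈ Finset.range d, ((q : ℝ) ^ n - (q : ℝ) ^ i) := by
  push_cast
  refine Finset.prod_congr rfl fun i hi => ?_
  have hi := Finset.mem_range.1 hi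
  rw [Nat.cast_sub (Nat.pow_le_pow_right hq (by omega))]
  simp

lemma card_directTuple_eq [Fintype K] [Finite V] {ι : Type*} [Fintype ι] {d : ℕ}
    (h : Fintype.card ι * d ≤ Module.finrank K V) :
    (Nat.card (DirectTuple K V ι d) : ℝ) * (Fintype.card K : ℝ) ^ (d * d * Fintype.card ι) =
      eulerProd (Fintype.card K) d ^ Fintype.card ι *
        ∏ i ∈ Finset.range (Fintype.card ι * d),
          ((Fintype.card K : ℝ) ^ Module.finrank K V - (Fintype.card K : ℝ) ^ i) := by
  have hq : 1 < (Fintype.card K : ℝ) := by exact_mod_cast Fintype.one_lt_card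
  have hq0 : 0 < Fintype.card K := Fintype.card_pos
  have := congrArg (Nat.cast : ℕ → ℝ) (card_directTuple (K := K) (V := V) h)
  rw [cast_prod_pow_sub_pow hq0 h, Nat.cast_mul, Nat.cast_pow,
    cast_prod_pow_sub_pow hq0 le_rfl] at this
  rw [← this, pow_mul, ← prod_pow_sub_pow hq d]
  ring

lemma numSubspaces_mul_le [Fintype K] [Finite V] (d : ℕ) :
    (numSubspaces K V d : ℝ) * (Fintype.card K : ℝ) ^ (d * d) ≤
      eulerProd (Fintype.card K) d * (Fintype.card K : ℝ) ^ (d * Module.finrank K V) := by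
  have hq : 1 < (Fintype.card K : ℝ) := by exact_mod_cast Fintype.one_lt_card
  have hE := eulerProd_pos hq d
  by_cases h : d ≤ Module.finrank K V
  · have := card_directTuple_eq (K := K) (V := V) (ι := Unit) (d := d) (by simpa using h)
    rw [numSubspaces_eq_card_directTuple]
    simp only [Fintype.card_unit, mul_one, one_mul, pow_one] at this
    rw [this, mul_comm d, pow_mul]
    refine mul_le_mul_of_nonneg_left ?_ hE.le
    refine (Finset.prod_le_prod (g := fun _ => (Fintype.card K : ℝ) ^ Module.finrank K V)
      (fun i hi => ?_) fun i _ => ?_).trans_eq (by simp)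
    · exact sub_nonneg.2 (pow_le_pow_right₀ hq.le ((Finset.mem_range.1 hi).le.trans h))
    · exact sub_le_self _ (by positivity)
  · have : IsEmpty {H : Submodule K V // Module.finrank K H = d} :=
      ⟨fun H => h (H.2 ▸ Submodule.finrank_le H.1)⟩
    rw [numSubspaces, Nat.card_of_isEmpty]
    simp only [Nat.cast_zero, zero_mul]
    positivity

end Counting

/-! ### Counting alternating maps coordinate by coordinate. -/

section Coordinates

variable {K V W : Type*} [Field K] [AddCommGroup V] [Module K V] [AddCommGroup W] [Module K W]

/-- The composition of an alternating map with a functional. -/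
def compFunctional (ρ : Module.Dual K W) (B : Alt K V W) : Alt K V K :=
  ⟨B.1.compr₂ ρ, fun x => by
    have : B.1 x x = 0 := B.2 x
    simp [this]⟩

lemma compFunctional_apply (ρ : Module.Dual K W) (B : Alt K V W) (x y : V) :
    (compFunctional ρ B).1 x y = ρ (B.1 x y) := rfl

/-- Alternating maps with prescribed spaces of coordinates. -/
noncomputable def coordEquiv {ι : Type*} (e : W ≃ₗ[K] (ι → K))
    (A : ι → Submodule K (Alt K V K)) :
    {B : Alt K V W // ∀ i, compFunctional (LinearMap.proj i ∘ₗ e.toLinearMap) B ∈ A i} ≃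
      ∀ i, A i where
  toFun B i := ⟨_, B.2 i⟩
  invFun b := ⟨⟨LinearMap.mk₂ K (fun x y => e.symm fun i => (b i).1.1 x y)
      (fun x x' y => by
        rw [← map_add]; congr 1; ext i; simp)
      (fun c x y => by
        rw [← map_smul]; congr 1; ext i; simp)
      (fun x y y' => by
        rw [← map_add]; congr 1; ext i; simp)
      (fun c x y => by
        rw [← map_smul]; congr 1; ext i; simp), fun x => by
        have : ∀ i, (b i).1.1 x x = 0 := fun i => (b i).1.2 x
        simp only [LinearMap.mk₂_apply, this]
        exact map_zero _⟩, fun i => by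
        convert (b i).2
        refine Subtype.ext ?_
        ext x y
        simp [compFunctional_apply]⟩
  left_inv B := by
    refine Subtype.ext (Subtype.ext ?_)
    ext x y
    simp [compFunctional_apply]
  right_inv b := by
    ext i x y
    simp [compFunctional_apply]

lemma totallyIsotropic_iff {B : V →ₗ[K] V →ₗ[K] W} {H : Submodule K V} :
    TotallyIsotropic B H ↔ ∀ x ∈ H, ∀ y ∈ H, B x y = 0 := by
  rw [TotallyIsotropic, ← le_bot_iff, Submodule.map₂_le]
  simp

instance instFiniteTypeAlt [Finite V] [Finite W] : Finite (Alt K V W) :=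
  have : Finite (V →ₗ[K] W) := DFunLike.finite _
  have : Finite (V →ₗ[K] V →ₗ[K] W) := DFunLike.finite _
  Subtype.finite

noncomputable instance instFintypeAlt [Finite V] [Finite W] : Fintype (Alt K V W) :=
  Fintype.ofFinite _

lemma card_eq_pow_finrank [Fintype K] [Finite V] (A : Submodule K (Alt K V K)) :
    Nat.card A = Fintype.card K ^ Module.finrank K A := by
  rw [Module.natCard_eq_pow_finrank (K := K), Nat.card_eq_fintype_card]

lemma card_alt_eq [Fintype K] [Finite V] {ι : Type*} [Fintype ι] (e : W ≃ₗ[K] (ι → K)) :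
    Nat.card (Alt K V W) =
      Fintype.card K ^ (Module.finrank K (Alt K V K) * Fintype.card ι) := by
  have h := Nat.card_congr (coordEquiv (V := V) e fun _ => ⊤)
  rw [Nat.card_pi] at h
  simp only [card_eq_pow_finrank, finrank_top, Finset.prod_const, Finset.card_univ,
    ← pow_mul] at h
  rw [← h]
  exact Nat.card_congr (Equiv.subtypeUnivEquiv fun B i => Submodule.mem_top).symm

lemma card_totallyIsotropic [Fintype K] [Finite V] (m : ℕ) (S : Finset (Submodule K V)) :
    Nat.card {B : Alt K V (Fin m → K) // ∀ H ∈ S, TotallyIsotropic B.1 H} =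
      Fintype.card K ^ (Module.finrank K (S.inf vanishing : Submodule K (Alt K V K)) * m) := by
  have h := Nat.card_congr (coordEquiv (V := V) (LinearEquiv.refl K (Fin m → K))
    fun _ => S.inf vanishing)
  rw [Nat.card_pi] at h
  simp only [card_eq_pow_finrank, Finset.prod_const, Finset.card_univ, ← pow_mul,
    Fintype.card_fin] at h
  rw [← h]
  refine Nat.card_congr (Equiv.subtypeEquivRight fun B => ?_)
  simp only [totallyIsotropic_iff, Submodule.mem_finsetInf, mem_vanishing, compFunctional_apply]
  constructor
  · intro hB i H hH x hx y hy
    simp [hB H hH x hx y hy]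
  · intro hB H hH x hx y hy
    ext i
    exact hB i H hH x hx y hy

lemma card_totallyIsotropic_mul_le [Fintype K] [Finite V] (m : ℕ) {S : Finset (Submodule K V)}
    (hS : ∀ H ∈ S, Module.finrank K H = 3)
    (hd : Module.finrank K (S.sup id : Submodule K V) ≠ 3 * S.card) :
    Nat.card {B : Alt K V (Fin m → K) // ∀ H ∈ S, TotallyIsotropic B.1 H} *
        Fintype.card K ^ ((Module.finrank K (S.sup id : Submodule K V) + 1) * m) ≤
      Nat.card (Alt K V (Fin m → K)) := by
  classical
  rw [card_totallyIsotropic, card_alt_eq (LinearEquiv.refl K (Fin m → K)), ← pow_add, ← add_mul,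
    Fintype.card_fin]
  refine Nat.pow_le_pow_right Fintype.card_pos (Nat.mul_le_mul_right _ ?_)
  exact finrank_inf_vanishing_add_finrank_sup_lt S hS hd

lemma card_totallyIsotropic_mul_eq [Fintype K] [Finite V] (m : ℕ) {S : Finset (Submodule K V)}
    (hS : ∀ H ∈ S, Module.finrank K H = 3)
    (hd : Module.finrank K (S.sup id : Submodule K V) = 3 * S.card) :
    Nat.card {B : Alt K V (Fin m → K) // ∀ H ∈ S, TotallyIsotropic B.1 H} *
        Fintype.card K ^ (3 * S.card * m) =
      Nat.card (Alt K V (Fin m → K)) := by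
  classical
  rw [card_totallyIsotropic, card_alt_eq (LinearEquiv.refl K (Fin m → K)), ← pow_add, ← add_mul,
    Fintype.card_fin, finrank_inf_vanishing_of_independent S hS hd]

lemma exists_coordinates [FiniteDimensional K W] (U : Submodule K W) {a c : ℕ}
    (ha : Module.finrank K U = a) (hc : Module.finrank K W = a + c) :
    ∃ e : W ≃ₗ[K] (Fin a ⊕ Fin c → K), ∀ x ∈ U, ∀ j, e x (Sum.inr j) = 0 := by
  obtain ⟨C, hC⟩ := Submodule.exists_isCompl U
  have hfC : Module.finrank K C = c := by
    have := Submodule.finrank_add_eq_of_isCompl hC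
    omega
  have b := Module.finBasisOfFinrankEq K U ha
  have b' := Module.finBasisOfFinrankEq K C hfC
  refine ⟨(Submodule.prodEquivOfIsCompl U C hC).symm ≪≫ₗ
    (b.equivFun.prodCongr b'.equivFun) ≪≫ₗ
    (LinearEquiv.sumArrowLequivProdArrow (Fin a) (Fin c) K K).symm, fun x hx j => ?_⟩
  have : (Submodule.prodEquivOfIsCompl U C hC).symm x = (⟨x, hx⟩, 0) :=
    Submodule.prodEquivOfIsCompl_symm_apply_left _ _ hC ⟨x, hx⟩
  simp [this]

/-- In coordinates of W adapted to U, the c coordinates transverse to U must vanish on H, and each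
of them thereby loses at least C(dim H, 2) dimensions. -/
lemma card_map₂_le_mul_le [Fintype K] [Finite V] [Finite W] (H : Submodule K V)
    (U : Submodule K W) {c : ℕ} (hc : Module.finrank K W = Module.finrank K U + c) :
    Nat.card {B : Alt K V W // Submodule.map₂ B.1 H H ≤ U} *
        Fintype.card K ^ ((Module.finrank K H).choose 2 * c) ≤ Nat.card (Alt K V W) := by
  obtain ⟨e, he⟩ := exists_coordinates U rfl hc
  have h1 := Nat.card_congr (coordEquiv (V := V) e (Sum.elim (fun _ => ⊤) fun _ => vanishing H))
  rw [Nat.card_pi, Fintype.prod_sum_type] at h1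
  simp only [Sum.elim_inl, Sum.elim_inr, card_eq_pow_finrank, finrank_top, Finset.prod_const,
    Finset.card_univ, ← pow_mul, Fintype.card_fin, ← pow_add] at h1
  have h2 : Nat.card {B : Alt K V W // Submodule.map₂ B.1 H H ≤ U} ≤
      Nat.card {B : Alt K V W // ∀ i, compFunctional (LinearMap.proj i ∘ₗ e.toLinearMap) B ∈
        (Sum.elim (fun _ => ⊤) fun _ => vanishing H : _ → Submodule K (Alt K V K)) i} := by
    refine Nat.card_le_card_of_injective
      (Subtype.map id fun B hB => ?_) (Subtype.map_injective _ Function.injective_id)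
    rintro (i | j)
    · exact Submodule.mem_top
    · exact fun x hx y hy => he _ (Submodule.map₂_le.1 hB x hx y hy) j
  refine (Nat.mul_le_mul_right _ (h2.trans_eq h1)).trans ?_
  rw [card_alt_eq e, ← pow_add, Fintype.card_sum, Fintype.card_fin, Fintype.card_fin, mul_add,
    add_assoc, ← add_mul]
  exact Nat.pow_le_pow_right Fintype.card_pos (Nat.add_le_add_left
    (Nat.mul_le_mul_right _ (finrank_vanishing_add_le H)) _)

end Coordinates

/-! ### Double counting and falling factorials. -/

section DoubleCounting

lemma sum_card_comm {α β : Type*} [Fintype α] [Fintype β] (R : α → β → Prop) :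
    ∑ a, Nat.card {b // R a b} = ∑ b, Nat.card {a // R a b} := by
  classical
  simp only [Nat.card_eq_fintype_card, Fintype.card_subtype, Finset.card_filter]
  exact Finset.sum_comm

/-- Falling factorials count ordered tuples of distinct elements, which is why factorial moments
become sums over tuples of subspaces. -/
lemma card_injective_tuples {α : Type*} [Finite α] (P R : α → Prop) (k : ℕ) :
    Nat.card {H : {H : Fin k → α // Function.Injective H ∧ ∀ i, P (H i)} // ∀ i, R (H.1 i)} =
      ({a | R a ∧ P a}.ncard).descFactorial k := by
  classical
  have := Fintype.ofFinite α
  have h := Fintype.card_embedding_eq (α := Fin k) (β := {a // R a ∧ P a})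
  rw [Fintype.card_fin, ← Nat.card_eq_fintype_card, ← Nat.card_eq_fintype_card] at h
  refine Eq.trans (Nat.card_congr ?_) h
  exact
    { toFun := fun H => ⟨fun i => ⟨H.1.1 i, H.2 i, H.1.2.2 i⟩,
        fun i j hij => H.1.2.1 (congrArg Subtype.val hij)⟩
      invFun := fun f => ⟨⟨fun i => (f i).1, fun i j hij => f.injective (Subtype.ext hij),
        fun i => (f i).2.2⟩, fun i => (f i).2.1⟩
      left_inv := fun _ => rfl
      right_inv := fun _ => rfl }

end DoubleCounting

/-! ### Factorial moments as sums over tuples of 3-spaces. -/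

section Moments

variable {K V : Type*} [Field K] [AddCommGroup V] [Module K V]

/-- The `k`-tuples of distinct three-dimensional subspaces. -/
abbrev DistinctTuple (K V : Type*) [Field K] [AddCommGroup V] [Module K V] (k : ℕ) : Type _ :=
  {H : Fin k → Submodule K V // Function.Injective H ∧ ∀ i, Module.finrank K (H i) = 3}

/-- The number of alternating maps for which all members of the tuple are totally isotropic. -/
noncomputable def tupleWeight (m : ℕ) {k : ℕ} (H : Fin k → Submodule K V) : ℕ :=
  Nat.card {B : Alt K V (Fin m → K) // ∀ i, TotallyIsotropic B.1 (H i)}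

/-- The number of totally isotropic three-dimensional subspaces. -/
noncomputable def numIsotropic {W : Type*} [AddCommGroup W] [Module K W] (B : Alt K V W) : ℕ :=
  {H : Submodule K V | TotallyIsotropic B.1 H ∧ Module.finrank K H = 3}.ncard

lemma tupleWeight_eq (m : ℕ) {k : ℕ} [DecidableEq (Submodule K V)] (H : Fin k → Submodule K V) :
    tupleWeight m H = Nat.card {B : Alt K V (Fin m → K) //
      ∀ H' ∈ Finset.univ.image H, TotallyIsotropic B.1 H'} := by
  simp [tupleWeight]

lemma sup_image_eq_iSup {k : ℕ} [DecidableEq (Submodule K V)] (H : Fin k → Submodule K V) :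
    (Finset.univ.image H).sup id = ⨆ i, H i := by
  rw [Finset.sup_image, Finset.sup_univ_eq_iSup]
  rfl

variable [Finite V]

lemma finrank_iSup_le {k : ℕ} (H : Fin k → Submodule K V) (hH : ∀ i, Module.finrank K (H i) = 3) :
    Module.finrank K (⨆ i, H i : Submodule K V) ≤ 3 * k := by
  classical
  rw [← sup_image_eq_iSup]
  refine (finrank_sup_le _ fun H' h' => ?_).trans (Nat.mul_le_mul_left 3 ?_)
  · obtain ⟨i, -, rfl⟩ := Finset.mem_image.1 h'
    exact hH i
  · exact Finset.card_image_le.trans (by simp)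

lemma injective_of_finrank_iSup {k : ℕ} {H : Fin k → Submodule K V}
    (hH : ∀ i, Module.finrank K (H i) = 3)
    (hd : Module.finrank K (⨆ i, H i : Submodule K V) = 3 * k) : Function.Injective H := by
  classical
  have h1 := finrank_sup_le (Finset.univ.image H) fun H' h' => by
    obtain ⟨i, -, rfl⟩ := Finset.mem_image.1 h'
    exact hH i
  rw [sup_image_eq_iSup, hd] at h1
  have h2 : (Finset.univ.image H).card ≤ k := Finset.card_image_le.trans (by simp)
  have h3 : (Finset.univ.image H).card = (Finset.univ : Finset (Fin k)).card := by
    rw [Finset.card_univ, Fintype.card_fin]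
    omega
  have := Finset.card_image_iff.1 h3
  simpa using this

lemma card_direct_distinctTuple (k : ℕ) :
    Nat.card {H : DistinctTuple K V k //
        Module.finrank K (⨆ i, H.1 i : Submodule K V) = 3 * k} =
      Nat.card (DirectTuple K V (Fin k) 3) := by
  refine Nat.card_congr
    { toFun := fun H => ⟨H.1.1, H.1.2.2, by rw [H.2, Fintype.card_fin, mul_comm]⟩
      invFun := fun H =>
        have h : Module.finrank K (⨆ i, H.1 i : Submodule K V) = 3 * k := by
          rw [H.2.2, Fintype.card_fin, mul_comm]
        ⟨⟨H.1, injective_of_finrank_iSup H.2.1 h, H.2.1⟩, h⟩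
      left_inv := fun _ => rfl
      right_inv := fun _ => rfl }

variable [Fintype K]

lemma tupleWeight_mul_eq (m : ℕ) {k : ℕ} (H : DistinctTuple K V k)
    (hd : Module.finrank K (⨆ i, H.1 i : Submodule K V) = 3 * k) :
    tupleWeight m H.1 * Fintype.card K ^ (3 * k * m) = Nat.card (Alt K V (Fin m → K)) := by
  classical
  have hc : (Finset.univ.image H.1).card = k := by
    rw [Finset.card_image_of_injective _ H.2.1, Finset.card_univ, Fintype.card_fin]
  have h := card_totallyIsotropic_mul_eq m (S := Finset.univ.image H.1) (fun H' h' => by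
    obtain ⟨i, -, rfl⟩ := Finset.mem_image.1 h'
    exact H.2.2 i) (by rw [sup_image_eq_iSup, hd, hc])
  rwa [hc, ← tupleWeight_eq] at h

lemma tupleWeight_mul_le (m : ℕ) {k : ℕ} (H : DistinctTuple K V k)
    (hd : Module.finrank K (⨆ i, H.1 i : Submodule K V) ≠ 3 * k) :
    tupleWeight m H.1 *
        Fintype.card K ^ ((Module.finrank K (⨆ i, H.1 i : Submodule K V) + 1) * m) ≤
      Nat.card (Alt K V (Fin m → K)) := by
  classical
  have hc : (Finset.univ.image H.1).card = k := by
    rw [Finset.card_image_of_injective _ H.2.1, Finset.card_univ, Fintype.card_fin]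
  rw [tupleWeight_eq, ← sup_image_eq_iSup]
  refine card_totallyIsotropic_mul_le m (fun H' h' => ?_) ?_
  · obtain ⟨i, -, rfl⟩ := Finset.mem_image.1 h'
    exact H.2.2 i
  · rw [sup_image_eq_iSup, hc]
    exact hd

lemma sum_descFactorial [Fintype (DistinctTuple K V k)] (m : ℕ) :
    ∑ B : Alt K V (Fin m → K), (numIsotropic B).descFactorial k =
      ∑ H : DistinctTuple K V k, tupleWeight m H.1 := by
  simp only [tupleWeight]
  rw [← sum_card_comm fun (B : Alt K V (Fin m → K)) (H : DistinctTuple K V k) =>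
    ∀ i, TotallyIsotropic B.1 (H.1 i)]
  refine Finset.sum_congr rfl fun B _ => ?_
  exact (card_injective_tuples (fun H : Submodule K V => Module.finrank K H = 3)
    (fun H => TotallyIsotropic B.1 H) k).symm

/-- Choose the sum D first, then each member as a 3-space inside D; distinctness is dropped. -/
lemma card_distinctTuple_finrank_le (k d : ℕ) :
    (Nat.card {H : DistinctTuple K V k //
        Module.finrank K (⨆ i, H.1 i : Submodule K V) = d} : ℝ) ≤
      numSubspaces K V d *
        (eulerProd (Fintype.card K) 3 * (Fintype.card K : ℝ) ^ (3 * d) /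
          (Fintype.card K : ℝ) ^ 9) ^ k := by
  classical
  have hle : Nat.card {H : DistinctTuple K V k //
        Module.finrank K (⨆ i, H.1 i : Submodule K V) = d} ≤
      Nat.card (Σ D : {D : Submodule K V // Module.finrank K D = d},
        Fin k → {H : Submodule K D.1 // Module.finrank K H = 3}) := by
    let f : {H : DistinctTuple K V k // Module.finrank K (⨆ i, H.1 i : Submodule K V) = d} →
        Σ D : {D : Submodule K V // Module.finrank K D = d},
          Fin k → {H : Submodule K D.1 // Module.finrank K H = 3} := fun H =>
      ⟨⟨⨆ i, H.1.1 i, H.2⟩, fun i => ⟨(H.1.1 i).submoduleOf (⨆ i, H.1.1 i), by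
        rw [LinearEquiv.finrank_eq (Submodule.submoduleOfEquivOfLe (le_iSup H.1.1 i))]
        exact H.1.2.2 i⟩⟩
    let g : (Σ D : {D : Submodule K V // Module.finrank K D = d},
          Fin k → {H : Submodule K D.1 // Module.finrank K H = 3}) → Fin k → Submodule K V :=
      fun t i => (t.2 i).1.map t.1.1.subtype
    have hgf : ∀ H, g (f H) = H.1.1 := fun H => by
      funext i
      change ((H.1.1 i).submoduleOf (⨆ i, H.1.1 i)).map (⨆ i, H.1.1 i).subtype = H.1.1 i
      rw [Submodule.submoduleOf, Submodule.map_comap_subtype]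
      exact inf_eq_right.2 (le_iSup H.1.1 i)
    refine Nat.card_le_card_of_injective f fun H H' h => ?_
    exact Subtype.ext (Subtype.ext (by rw [← hgf, ← hgf, h]))
  have := Fintype.ofFinite {D : Submodule K V // Module.finrank K D = d}
  rw [Nat.card_sigma] at hle
  refine (Nat.cast_le.2 hle).trans ?_
  rw [Nat.cast_sum, numSubspaces, Nat.card_eq_fintype_card, ← nsmul_eq_mul, ← Finset.card_univ]
  refine Finset.sum_le_card_nsmul _ _ _ fun D _ => ?_
  rw [Nat.card_fun, Nat.card_eq_fintype_card (α := Fin k), Fintype.card_fin, Nat.cast_pow]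
  refine pow_le_pow_left₀ (Nat.cast_nonneg _) ?_ k
  have h := numSubspaces_mul_le (K := K) (V := D.1) 3
  have hq : 0 < (Fintype.card K : ℝ) := by exact_mod_cast Fintype.card_pos
  rw [le_div_iff₀ (by positivity)]
  rw [D.2] at h
  exact h

lemma le_sum_descFactorial (m k : ℕ) :
    Nat.card (DirectTuple K V (Fin k) 3) / (Fintype.card K : ℝ) ^ (3 * k * m) *
        Nat.card (Alt K V (Fin m → K)) ≤
      ((∑ B : Alt K V (Fin m → K), (numIsotropic B).descFactorial k : ℕ) : ℝ) := by
  classical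
  have hq : 0 < (Fintype.card K : ℝ) := by exact_mod_cast Fintype.card_pos
  have := Fintype.ofFinite (DistinctTuple K V k)
  rw [sum_descFactorial, ← card_direct_distinctTuple, Nat.card_eq_fintype_card,
    Fintype.card_subtype, div_mul_eq_mul_div, mul_div_assoc, ← nsmul_eq_mul]
  refine le_trans ?_ (Nat.cast_le.2 (Finset.sum_le_sum_of_subset (Finset.filter_subset
    (fun H : DistinctTuple K V k =>
      Module.finrank K (⨆ i, H.1 i : Submodule K V) = 3 * k) Finset.univ)))
  rw [Nat.cast_sum]
  refine Finset.card_nsmul_le_sum _ _ _ fun H hH => ?_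
  rw [div_le_iff₀ (by positivity)]
  exact_mod_cast (tupleWeight_mul_eq m H (Finset.mem_filter.1 hH).2).ge

/-- Tuples are sorted by the dimension d of their sum. The top value d = 3k is the main term, and
each d below it profits from the extra condition in `tupleWeight_mul_le`. -/
lemma sum_descFactorial_le (m k : ℕ) :
    ((∑ B : Alt K V (Fin m → K), (numIsotropic B).descFactorial k : ℕ) : ℝ) ≤
      (Nat.card (DirectTuple K V (Fin k) 3) / (Fintype.card K : ℝ) ^ (3 * k * m) +
        ∑ d ∈ Finset.range (3 * k), numSubspaces K V d *
          (eulerProd (Fintype.card K) 3 * (Fintype.card K : ℝ) ^ (3 * d) /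
            (Fintype.card K : ℝ) ^ 9) ^ k / (Fintype.card K : ℝ) ^ ((d + 1) * m)) *
        Nat.card (Alt K V (Fin m → K)) := by
  classical
  have hq : 0 < (Fintype.card K : ℝ) := by exact_mod_cast Fintype.card_pos
  have := Fintype.ofFinite (DistinctTuple K V k)
  rw [sum_descFactorial, ← Finset.sum_fiberwise_of_maps_to (t := Finset.range (3 * k + 1))
    (g := fun H : DistinctTuple K V k => Module.finrank K (⨆ i, H.1 i : Submodule K V))
    (fun H _ => Finset.mem_range.2 (Nat.lt_succ_of_le (finrank_iSup_le H.1 H.2.2))),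
    Finset.sum_range_succ, Nat.cast_add, add_comm, add_mul, Finset.sum_mul,
    Nat.cast_sum (Finset.range (3 * k))]
  refine add_le_add ?_ (Finset.sum_le_sum fun d hd => ?_)
  · rw [Nat.cast_sum, ← card_direct_distinctTuple, Nat.card_eq_fintype_card,
      Fintype.card_subtype, div_mul_eq_mul_div, mul_div_assoc, ← nsmul_eq_mul]
    refine Finset.sum_le_card_nsmul _ _ _ fun H hH => ?_
    rw [le_div_iff₀ (by positivity)]
    exact_mod_cast (tupleWeight_mul_eq m H (Finset.mem_filter.1 hH).2).le
  · rw [div_mul_eq_mul_div, mul_div_assoc]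
    refine le_trans ?_ (mul_le_mul_of_nonneg_right (card_distinctTuple_finrank_le k d)
      (by positivity))
    rw [Nat.cast_sum, Nat.card_eq_fintype_card, Fintype.card_subtype, ← nsmul_eq_mul]
    refine Finset.sum_le_card_nsmul _ _ _ fun H hH => ?_
    have hHd := (Finset.mem_filter.1 hH).2
    rw [le_div_iff₀ (by positivity)]
    have hne : Module.finrank K (⨆ i, H.1 i : Submodule K V) ≠ 3 * k :=
      hHd.trans_ne (Finset.mem_range.1 hd).ne
    have h := tupleWeight_mul_le m H hne
    rw [hHd] at h
    exact_mod_cast h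

end Moments

/-! ### Bounds for Euler products. -/

section Estimates

lemma prod_one_sub_mem_Icc {ι : Type*} (s : Finset ι) {f : ι → ℝ} (h0 : ∀ i ∈ s, 0 ≤ f i)
    (h1 : ∀ i ∈ s, f i ≤ 1) :
    1 - ∑ i ∈ s, f i ≤ ∏ i ∈ s, (1 - f i) ∧ ∏ i ∈ s, (1 - f i) ≤ 1 := by
  classical
  refine ⟨?_, Finset.prod_le_one (fun i hi => sub_nonneg.2 (h1 i hi))
    fun i hi => sub_le_self _ (h0 i hi)⟩
  induction s using Finset.induction_on with
  | empty => simp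
  | insert a s ha ih =>
    rw [Finset.sum_insert ha, Finset.prod_insert ha]
    have hs0 : ∀ i ∈ s, 0 ≤ f i := fun i hi => h0 i (Finset.mem_insert_of_mem hi)
    have h := ih hs0 fun i hi => h1 i (Finset.mem_insert_of_mem hi)
    have ha0 := h0 a (Finset.mem_insert_self a s)
    have ha1 := h1 a (Finset.mem_insert_self a s)
    have := mul_le_mul_of_nonneg_left h (sub_nonneg.2 ha1)
    nlinarith [mul_nonneg ha0 (Finset.sum_nonneg hs0)]

lemma eulerProd_succ (q : ℝ) (d : ℕ) :
    eulerProd q (d + 1) = eulerProd q d * (1 - (q ^ (d + 1))⁻¹)⁻¹ := by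
  rw [eulerProd, Finset.prod_Icc_succ_top (by omega)]
  rfl

lemma eulerProd_le_of_le {q q' : ℝ} (hq : 1 < q) (hqq' : q ≤ q') (d : ℕ) :
    eulerProd q' d ≤ eulerProd q d := by
  have hq' : 1 < q' := hq.trans_le hqq'
  refine Finset.prod_le_prod (fun i hi => ?_) fun i hi => ?_ <;>
    have hi : i ≠ 0 := by have := Finset.mem_Icc.1 hi; omega
  · exact (inv_pos.2 (one_sub_inv_pow_pos hq' hi)).le
  · refine inv_anti₀ (one_sub_inv_pow_pos hq hi) (sub_le_sub_left ?_ 1)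
    exact inv_anti₀ (by positivity) (pow_le_pow_left₀ (by linarith) hqq' i)

lemma eulerProd_mono {q : ℝ} (hq : 1 < q) : Monotone (eulerProd q) := by
  refine monotone_nat_of_le_succ fun d => ?_
  rw [eulerProd_succ]
  refine le_mul_of_one_le_right (eulerProd_pos hq d).le ?_
  exact (one_le_inv₀ (one_sub_inv_pow_pos hq d.succ_ne_zero)).2 (sub_le_self _ (by positivity))

lemma one_le_eulerProd {q : ℝ} (hq : 1 < q) (d : ℕ) : 1 ≤ eulerProd q d := by
  have := eulerProd_mono hq (Nat.zero_le d)
  simpa [eulerProd] using this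

/-- The bound ∏ (1 - 2^(-i)) ≥ 1/4 is not inductive by itself; the added power of 1/2 pays for the
next factor and gives equality at the start. -/
lemma eulerProd_two_mul_le (d : ℕ) :
    eulerProd 2 (d + 1) * (1 / 4 + (1 / 2) ^ (d + 2)) ≤ 1 := by
  induction d with
  | zero => norm_num [eulerProd]
  | succ d ih =>
    have hx : ((2 : ℝ) ^ (d + 1 + 1))⁻¹ = (1 / 2) ^ (d + 2) := by simp
    have hpos := eulerProd_pos (q := 2) (by norm_num) (d + 1)
    rw [eulerProd_succ, hx]
    set x : ℝ := (1 / 2) ^ (d + 2) with hxdef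
    have hx0 : 0 < x := by positivity
    have hx1 : x ≤ 1 / 4 := by
      have := pow_le_pow_of_le_one (by norm_num : (0 : ℝ) ≤ 1 / 2) (by norm_num)
        (show 2 ≤ d + 2 by omega)
      rw [hxdef]
      linarith
    have hx2 : (1 / 2 : ℝ) ^ (d + 1 + 2) = x / 2 := by
      rw [hxdef]
      ring
    rw [hx2]
    refine le_trans ?_ ih
    rw [mul_assoc]
    refine mul_le_mul_of_nonneg_left ?_ hpos.le
    rw [← div_eq_inv_mul, div_le_iff₀ (by linarith)]
    nlinarith

lemma eulerProd_le_four {q : ℝ} (hq : 2 ≤ q) (d : ℕ) : eulerProd q d ≤ 4 := by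
  have h1 := (eulerProd_mono (q := 2) (by norm_num) (Nat.le_succ d)).trans'
    (eulerProd_le_of_le (by norm_num) hq d)
  have h2 := eulerProd_two_mul_le d
  have h3 := eulerProd_pos (q := 2) (by norm_num) (d + 1)
  have h4 : (0 : ℝ) < (1 / 2) ^ (d + 2) := by positivity
  nlinarith

end Estimates

/-! ### Two-sided bounds for the factorial moments. -/

section MomentBounds

lemma two_le_card {K : Type*} [Field K] [Fintype K] : (2 : ℝ) ≤ Fintype.card K := by
  exact_mod_cast Fintype.one_lt_card (α := K)

variable {K V : Type*} [Field K] [AddCommGroup V] [Module K V] [Finite V]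

lemma card_alt_pos (W : Type*) [AddCommGroup W] [Module K W] [Finite W] :
    (0 : ℝ) < Nat.card (Alt K V W) := by
  exact_mod_cast Nat.card_pos

/-- The `k`-th factorial moment of the number of totally isotropic three-dimensional subspaces. -/
noncomputable def factorialMoment (K V : Type*) [Field K] [AddCommGroup V] [Module K V] [Finite K]
    [Finite V] (m k : ℕ) : ℝ :=
  (∑ B : Alt K V (Fin m → K), ((numIsotropic B).descFactorial k : ℝ)) /
    Nat.card (Alt K V (Fin m → K))

variable [Fintype K]

lemma card_directTuple_div {m k : ℕ} (hV : Module.finrank K V = m + 3) (hk : 3 * k ≤ m + 3) :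
    Nat.card (DirectTuple K V (Fin k) 3) / (Fintype.card K : ℝ) ^ (3 * k * m) =
      eulerProd (Fintype.card K) 3 ^ k *
        ∏ i ∈ Finset.range (3 * k), (1 - (Fintype.card K : ℝ) ^ i / Fintype.card K ^ (m + 3)) := by
  have hq := two_le_card (K := K)
  have h := card_directTuple_eq (K := K) (V := V) (ι := Fin k) (d := 3)
    (by rw [Fintype.card_fin, hV]; omega)
  rw [Fintype.card_fin, hV] at h
  set q : ℝ := (Fintype.card K : ℝ)
  have hprod : ∏ i ∈ Finset.range (k * 3), (q ^ (m + 3) - q ^ i) =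
      q ^ ((m + 3) * (3 * k)) * ∏ i ∈ Finset.range (3 * k), (1 - q ^ i / q ^ (m + 3)) := by
    rw [mul_comm k, pow_mul, ← Finset.card_range (3 * k), ← Finset.prod_const,
      Finset.card_range, ← Finset.prod_mul_distrib]
    refine Finset.prod_congr rfl fun i _ => ?_
    field_simp
  rw [hprod] at h
  rw [div_eq_iff (by positivity)]
  have hpow : q ^ ((m + 3) * (3 * k)) = q ^ (3 * k * m) * q ^ (3 * 3 * k) := by
    rw [← pow_add]
    ring
  rw [hpow] at h
  refine mul_right_cancel₀ (b := q ^ (3 * 3 * k)) (by positivity) (h.trans ?_)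
  ring

lemma sum_range_pow_le {q : ℝ} (hq : 2 ≤ q) (k : ℕ) : ∑ i ∈ Finset.range k, q ^ i ≤ q ^ k := by
  induction k with
  | zero => simp
  | succ k ih =>
    rw [Finset.sum_range_succ, pow_succ]
    nlinarith [pow_pos (by linarith : 0 < q) k]

lemma le_factorialMoment {m k : ℕ} (hV : Module.finrank K V = m + 3) (hk : 3 * k ≤ m + 3) :
    eulerProd (Fintype.card K) 3 ^ k *
        (1 - (Fintype.card K : ℝ) ^ (3 * k) / (Fintype.card K : ℝ) ^ (m + 3)) ≤
      factorialMoment K V m k := by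
  have hq := two_le_card (K := K)
  have h := le_sum_descFactorial (K := K) (V := V) m k
  rw [card_directTuple_div hV hk, ← le_div_iff₀ (card_alt_pos _), Nat.cast_sum] at h
  refine le_trans ?_ h
  refine mul_le_mul_of_nonneg_left ?_ (pow_nonneg (eulerProd_pos (by linarith) 3).le k)
  refine le_trans ?_ (prod_one_sub_mem_Icc _ (fun i _ => by positivity) fun i hi => ?_).1
  · rw [← Finset.sum_div]
    exact sub_le_sub_left (div_le_div_of_nonneg_right (sum_range_pow_le hq _) (by positivity)) 1
  · refine div_le_one_of_le₀ (pow_le_pow_right₀ (by linarith) ?_) (by positivity)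
    have := Finset.mem_range.1 hi
    omega

lemma numSubspaces_term_le {m : ℕ} (hV : Module.finrank K V = m + 3) (k d : ℕ) :
    numSubspaces K V d *
          (eulerProd (Fintype.card K) 3 * (Fintype.card K : ℝ) ^ (3 * d) /
            (Fintype.card K : ℝ) ^ 9) ^ k / (Fintype.card K : ℝ) ^ ((d + 1) * m) ≤
      eulerProd (Fintype.card K) d * eulerProd (Fintype.card K) 3 ^ k *
        (Fintype.card K : ℝ) ^ (3 * d + 3 * d * k - d * d - 9 * k - m : ℤ) := by
  have hq := two_le_card (K := K)
  have h := numSubspaces_mul_le (K := K) (V := V) d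
  rw [hV] at h
  set q : ℝ := (Fintype.card K : ℝ)
  have hE := eulerProd_pos (q := q) (by linarith) 3
  -- The terms dm from counting the sums and (d + 1)m from the probability leave the single decaying
  -- factor q^(-m).
  have hz : q ^ (3 * d + 3 * d * k - d * d - 9 * k - m : ℤ) =
      q ^ (d * (m + 3)) * q ^ (3 * d * k) / (q ^ (d * d) * q ^ (9 * k) * q ^ ((d + 1) * m)) := by
    rw [← pow_add, ← pow_add, ← pow_add, ← zpow_natCast, ← zpow_natCast,
      ← zpow_sub₀ (by positivity)]
    congr 1
    push_cast
    ring
  rw [← le_div_iff₀ (by positivity)] at h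
  rw [hz]
  calc _ ≤ eulerProd q d * q ^ (d * (m + 3)) / q ^ (d * d) *
        (eulerProd q 3 * q ^ (3 * d) / q ^ 9) ^ k / q ^ ((d + 1) * m) := by
        gcongr
    _ = _ := by
        rw [div_pow, mul_pow, ← pow_mul, ← pow_mul]
        field_simp

lemma factorialMoment_le {m k : ℕ} (hV : Module.finrank K V = m + 3) (hk : 3 * k ≤ m + 3) :
    factorialMoment K V m k ≤ eulerProd (Fintype.card K) 3 ^ k *
      (1 + ∑ d ∈ Finset.range (3 * k), eulerProd (Fintype.card K) d *
        (Fintype.card K : ℝ) ^ (3 * d + 3 * d * k - d * d - 9 * k - m : ℤ)) := by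
  have hq := two_le_card (K := K)
  have h := sum_descFactorial_le (K := K) (V := V) m k
  rw [card_directTuple_div hV hk, ← div_le_iff₀ (card_alt_pos _), Nat.cast_sum] at h
  refine h.trans ?_
  rw [mul_add]
  refine add_le_add ?_ ?_
  · refine mul_le_mul_of_nonneg_left ?_ (pow_nonneg (eulerProd_pos (by linarith) 3).le k)
    refine (prod_one_sub_mem_Icc _ (fun i _ => by positivity) fun i hi => ?_).2
    refine div_le_one_of_le₀ (pow_le_pow_right₀ (by linarith) ?_) (by positivity)
    have := Finset.mem_range.1 hi
    omega
  · rw [Finset.mul_sum]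
    refine Finset.sum_le_sum fun d _ => (numSubspaces_term_le hV k d).trans_eq ?_
    ring

end MomentBounds

/-! ### Bad subspaces of dimension at least 4. -/

section LargeBad

variable {K V W : Type*} [Field K] [AddCommGroup V] [Module K V] [AddCommGroup W] [Module K W]

lemma exists_le_finrank_eq [FiniteDimensional K W] (X : Submodule K W) (j : ℕ)
    (h : Module.finrank K X + j ≤ Module.finrank K W) :
    ∃ U : Submodule K W, X ≤ U ∧ Module.finrank K U = Module.finrank K X + j := by
  induction j with
  | zero => exact ⟨X, le_rfl, rfl⟩
  | succ j ih =>
    obtain ⟨U, hXU, hU⟩ := ih (by omega)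
    obtain ⟨w, hw⟩ := U.exists_of_finrank_lt (by omega)
    have hwU : w ∉ U := by simpa using hw 1 one_ne_zero
    have hw0 : w ≠ 0 := fun h0 => hwU (h0 ▸ U.zero_mem)
    refine ⟨U ⊔ Submodule.span K {w}, hXU.trans le_sup_left, ?_⟩
    have hinf : U ⊓ Submodule.span K {w} = ⊥ := by
      rw [eq_bot_iff]
      rintro x ⟨hx, hx'⟩
      obtain ⟨r, rfl⟩ := Submodule.mem_span_singleton.1 hx'
      by_cases hr : r = 0
      · simp [hr]
      · exact absurd hx (hw r hr)
    have := Submodule.finrank_sup_add_finrank_inf_eq U (Submodule.span K {w})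
    rw [hinf, finrank_bot, finrank_span_singleton hw0] at this
    omega

lemma IsBad.finrank_add_le [FiniteDimensional K V] [FiniteDimensional K W]
    {B : V →ₗ[K] V →ₗ[K] W} {H : Submodule K V} (hB : IsBad B H) :
    Module.finrank K V + Module.finrank K (Submodule.map₂ B H H) ≤
      Module.finrank K W + Module.finrank K H := by
  have h1 := hB.2
  have h2 := Submodule.finrank_quotient_add_finrank H
  have h3 := Submodule.finrank_quotient_add_finrank (Submodule.map₂ B H H)
  omega

lemma isBad_iff_totallyIsotropic [FiniteDimensional K V] [FiniteDimensional K W]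
    {B : V →ₗ[K] V →ₗ[K] W} {H : Submodule K V}
    (hVW : Module.finrank K V = Module.finrank K W + 3) (hV : 3 < Module.finrank K V)
    (hH : Module.finrank K H = 3) : IsBad B H ↔ TotallyIsotropic B H := by
  constructor
  · intro h
    have := h.finrank_add_le
    exact Submodule.finrank_eq_zero.1 (by omega)
  · intro h
    rw [TotallyIsotropic] at h
    refine ⟨lt_top_iff_ne_top.2 fun htop => ?_, ?_⟩
    · rw [htop, finrank_top] at hH
      omega
    · have h1 := Submodule.finrank_quotient_add_finrank H
      have h2 := Submodule.finrank_quotient_add_finrank (Submodule.map₂ B H H)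
      rw [h, finrank_bot] at h2
      rw [h]
      omega

lemma not_isBad_of_finrank_lt [FiniteDimensional K V] [FiniteDimensional K W]
    {B : V →ₗ[K] V →ₗ[K] W} {H : Submodule K V}
    (hVW : Module.finrank K V = Module.finrank K W + 3) (hH : Module.finrank K H < 3) :
    ¬ IsBad B H := by
  intro h
  have := h.finrank_add_le
  omega

/-- Badness forces dim B(H, H) ≤ g, so B(H, H) can be enlarged to some U of dimension exactly g;
then apply the union bound over U. -/
lemma card_isBad_mul_le [Fintype K] [Finite V] [Finite W] {g c : ℕ} {H : Submodule K V}
    (hH : Module.finrank K H = g + 3) (hV : Module.finrank K V = g + 3 + c)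
    (hW : Module.finrank K W = g + c) :
    Nat.card {B : Alt K V W // IsBad B.1 H} * Fintype.card K ^ ((g + 3).choose 2 * c) ≤
      numSubspaces K W g * Nat.card (Alt K V W) := by
  classical
  have hU : ∀ B : {B : Alt K V W // IsBad B.1 H}, ∃ U : {U : Submodule K W //
      Module.finrank K U = g}, Submodule.map₂ B.1.1 H H ≤ U.1 := by
    intro B
    have h1 := B.2.finrank_add_le
    obtain ⟨U, h2, h3⟩ := exists_le_finrank_eq (Submodule.map₂ B.1.1 H H)
      (g - Module.finrank K (Submodule.map₂ B.1.1 H H)) (by omega)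
    exact ⟨⟨U, by omega⟩, h2⟩
  choose U hU using hU
  let f : {B : Alt K V W // IsBad B.1 H} → Σ U : {U : Submodule K W // Module.finrank K U = g},
      {B : Alt K V W // Submodule.map₂ B.1 H H ≤ U.1} := fun B => ⟨U B, B.1, hU B⟩
  let r : (Σ U : {U : Submodule K W // Module.finrank K U = g},
      {B : Alt K V W // Submodule.map₂ B.1 H H ≤ U.1}) → Alt K V W := fun t => t.2.1
  have hf : Function.Injective f := fun B B' h => Subtype.ext (congrArg r h)
  have := Fintype.ofFinite {U : Submodule K W // Module.finrank K U = g}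
  have hle := Nat.card_le_card_of_injective f hf
  rw [Nat.card_sigma] at hle
  refine (Nat.mul_le_mul_right _ hle).trans ?_
  rw [Finset.sum_mul, numSubspaces, Nat.card_eq_fintype_card, ← smul_eq_mul (Fintype.card _),
    ← Finset.card_univ]
  refine Finset.sum_le_card_nsmul _ _ _ fun U _ => ?_
  rw [← hH]
  exact card_map₂_le_mul_le H U.1 (by rw [U.2, hW])

lemma numSubspaces_le [Fintype K] [Finite V] {d c : ℕ} (h : Module.finrank K V = d + c) :
    (numSubspaces K V d : ℝ) ≤ 4 * (Fintype.card K : ℝ) ^ (d * c) := by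
  have hq := two_le_card (K := K)
  have h1 := numSubspaces_mul_le (K := K) (V := V) d
  rw [h, mul_add, pow_add] at h1
  have h2 := eulerProd_le_four hq d
  refine le_of_mul_le_mul_right (h1.trans ?_) (by positivity : 0 < (Fintype.card K : ℝ) ^ (d * d))
  rw [mul_comm ((Fintype.card K : ℝ) ^ (d * d)), ← mul_assoc]
  gcongr

/-- The first two terms are the exponents for the number of H and of U, and the right side is that
of the probability. The surplus g + 1 + c is n - 4 whatever the dimension of H; it is attained for
dim H = 4. -/
lemma exponent_le (g c : ℕ) :
    (g + 1 + 3) * (c + 1) + (g + 1) * (c + 1) + (g + 1 + c) ≤ (g + 1 + 3).choose 2 * (c + 1) := by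
  have h : (g + 1 + 3).choose 2 * 2 = (g + 4) * (g + 3) := by
    rw [Nat.choose_two_right]
    exact Nat.div_mul_cancel (Nat.even_mul_pred_self (g + 4)).two_dvd
  nlinarith [Nat.zero_le (g * c), Nat.zero_le (g * g * c), Nat.zero_le (g * g)]

lemma numSubspaces_mul_card_isBad_le [Fintype K] [Finite V] [Finite W] {g c : ℕ}
    {H : Submodule K V} (hH : Module.finrank K H = g + 1 + 3)
    (hV : Module.finrank K V = g + 1 + 3 + (c + 1)) (hW : Module.finrank K W = g + 1 + (c + 1)) :
    (numSubspaces K V (g + 1 + 3) : ℝ) * Nat.card {B : Alt K V W // IsBad B.1 H} ≤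
      16 / (Fintype.card K : ℝ) ^ (g + 1 + c) * Nat.card (Alt K V W) := by
  have hq := two_le_card (K := K)
  have h1 := card_isBad_mul_le hH hV hW
  have h2 := numSubspaces_le hV
  have h3 := numSubspaces_le hW
  have h1' : (Nat.card {B : Alt K V W // IsBad B.1 H} : ℝ) *
      (Fintype.card K : ℝ) ^ ((g + 1 + 3).choose 2 * (c + 1)) ≤
      numSubspaces K W (g + 1) * Nat.card (Alt K V W) := by exact_mod_cast h1
  set q : ℝ := (Fintype.card K : ℝ)
  set N : ℝ := (Nat.card (Alt K V W) : ℝ)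
  set X : ℝ := (Nat.card {B : Alt K V W // IsBad B.1 H} : ℝ)
  have h4 : q ^ ((g + 1 + 3) * (c + 1)) * q ^ ((g + 1) * (c + 1)) * q ^ (g + 1 + c) ≤
      q ^ ((g + 1 + 3).choose 2 * (c + 1)) := by
    rw [← pow_add, ← pow_add]
    exact pow_le_pow_right₀ (by linarith) (exponent_le g c)
  have hX : 0 ≤ X := Nat.cast_nonneg _
  have hN : 0 ≤ N := Nat.cast_nonneg _
  have h5 : X * (q ^ ((g + 1 + 3) * (c + 1)) * q ^ (g + 1 + c)) ≤ 4 * N := by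
    have := (mul_le_mul_of_nonneg_left h4 hX).trans
      (h1'.trans (mul_le_mul_of_nonneg_right h3 hN))
    have hpos : 0 < q ^ ((g + 1) * (c + 1)) := by positivity
    refine le_of_mul_le_mul_right ?_ hpos
    linarith
  rw [div_mul_eq_mul_div, le_div_iff₀ (by positivity)]
  calc (numSubspaces K V (g + 1 + 3) : ℝ) * X * q ^ (g + 1 + c)
      ≤ 4 * q ^ ((g + 1 + 3) * (c + 1)) * X * q ^ (g + 1 + c) := by gcongr
    _ ≤ 16 * N := by linarith

lemma sum_ncard_isBad_le [Fintype K] [Finite V] [Finite W] {m : ℕ}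
    (hV : Module.finrank K V = m + 1 + 3) (hW : Module.finrank K W = m + 1) :
    ((∑ B : Alt K V W, {H : Submodule K V | IsBad B.1 H ∧ 4 ≤ Module.finrank K H}.ncard : ℕ) : ℝ) ≤
      16 * m / (Fintype.card K : ℝ) ^ m * Nat.card (Alt K V W) := by
  classical
  let T := {H : Submodule K V // 4 ≤ Module.finrank K H ∧ H < ⊤}
  have : Fintype T := Fintype.ofFinite T
  have h1 : ∀ B : Alt K V W, {H : Submodule K V | IsBad B.1 H ∧ 4 ≤ Module.finrank K H}.ncard =
      Nat.card {H : T // IsBad B.1 H.1} := fun B => by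
    rw [← Nat.card_coe_set_eq]
    exact Nat.card_congr
      { toFun := fun H => ⟨⟨H.1, H.2.2, H.2.1.1⟩, H.2.1⟩
        invFun := fun H => ⟨H.1.1, H.2, H.1.2.1⟩
        left_inv := fun _ => rfl
        right_inv := fun _ => rfl }
  have hmaps : ∀ H ∈ (Finset.univ : Finset T), Module.finrank K H.1 ∈ Finset.Icc 4 (m + 3) := by
    intro H _
    have := Submodule.finrank_lt H.2.2.ne
    exact Finset.mem_Icc.2 ⟨H.2.1, by omega⟩
  rw [Finset.sum_congr rfl fun B _ => h1 B,
    sum_card_comm fun (B : Alt K V W) (H : T) => IsBad B.1 H.1,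
    ← Finset.sum_fiberwise_of_maps_to hmaps, Nat.cast_sum]
  have hcard : (Finset.Icc 4 (m + 3)).card = m := by simp
  have hgoal : 16 * (m : ℝ) / (Fintype.card K : ℝ) ^ m * Nat.card (Alt K V W) =
      (Finset.Icc 4 (m + 3)).card • (16 / (Fintype.card K : ℝ) ^ m * Nat.card (Alt K V W)) := by
    rw [hcard, nsmul_eq_mul]
    ring
  rw [hgoal]
  refine Finset.sum_le_card_nsmul _ _ _ fun h hh => ?_
  obtain ⟨h4, hm⟩ := Finset.mem_Icc.1 hh
  obtain ⟨g, rfl⟩ : ∃ g, h = g + 1 + 3 := ⟨h - 4, by omega⟩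
  obtain ⟨c, rfl⟩ : ∃ c, m = g + 1 + c := ⟨m - (g + 1), by omega⟩
  have hcount : (Finset.univ.filter fun H : T => Module.finrank K H.1 = g + 1 + 3).card ≤
      numSubspaces K V (g + 1 + 3) := by
    rw [numSubspaces, ← Fintype.card_subtype, ← Nat.card_eq_fintype_card]
    refine Nat.card_le_card_of_injective (fun H => ⟨H.1.1, H.2⟩) fun H H' h => ?_
    have h' : H.1.1 = H'.1.1 := congrArg (fun t => t.1) h
    exact Subtype.ext (Subtype.ext h')
  have hpos : 0 < (numSubspaces K V (g + 1 + 3) : ℝ) := by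
    obtain ⟨U, -, hU⟩ := exists_le_finrank_eq (⊥ : Submodule K V) (g + 1 + 3)
      (by rw [finrank_bot, hV]; omega)
    have : Nonempty {H : Submodule K V // Module.finrank K H = g + 1 + 3} :=
      ⟨⟨U, by rw [hU, finrank_bot, zero_add]⟩⟩
    exact_mod_cast Nat.card_pos
  rw [Nat.cast_sum]
  -- Each H gets an equal share of the bound for its dimension; the number of shares then cancels
  -- the denominator.
  refine (Finset.sum_le_card_nsmul _ _ (16 / (Fintype.card K : ℝ) ^ (g + 1 + c) *
    Nat.card (Alt K V W) / numSubspaces K V (g + 1 + 3)) fun H hH => ?_).trans ?_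
  · rw [le_div_iff₀ hpos, mul_comm]
    exact numSubspaces_mul_card_isBad_le (Finset.mem_filter.1 hH).2 (by rw [hV]; omega)
      (by rw [hW]; omega)
  · rw [nsmul_eq_mul, mul_div_assoc', div_le_iff₀ hpos, mul_comm]
    exact mul_le_mul_of_nonneg_left (Nat.cast_le.2 hcount) (by positivity)

end LargeBad

/-! ### Bonferroni inequalities and the method of factorial moments. -/

section Bonferroni

open Nat

/-- The truncated inversion formula for the probability of the value `m` in terms of factorial
moments. -/
noncomputable def truncInversion (M : ℕ → ℝ) (m J : ℕ) : ℝ :=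
  (∑ j ∈ Finset.range J, (-1) ^ j * M (m + j) / (j !)) / (m !)

lemma truncInversion_descFactorial_add (m t J : ℕ) :
    truncInversion (fun k => ((m + t).descFactorial k : ℝ)) m J =
      (m + t).choose m * ∑ j ∈ Finset.range J, (-1) ^ j * (t.choose j : ℝ) := by
  have h : ∀ j, ((m + t).descFactorial (m + j) : ℝ) =
      (m ! : ℝ) * (m + t).choose m * ((j ! : ℝ) * t.choose j) := by
    intro j
    rw [← Nat.descFactorial_mul_descFactorial (Nat.le_add_right m j), Nat.add_sub_cancel_left,
      Nat.add_sub_cancel_left, Nat.descFactorial_eq_factorial_mul_choose,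
      Nat.descFactorial_eq_factorial_mul_choose]
    push_cast
    ring
  rw [truncInversion, Finset.mul_sum, Finset.sum_div]
  refine Finset.sum_congr rfl fun j _ => ?_
  rw [h]
  have h1 : (m ! : ℝ) ≠ 0 := by positivity
  have h2 : (j ! : ℝ) ≠ 0 := by positivity
  field_simp

lemma sum_range_neg_one_pow_mul_choose (t J : ℕ) :
    ∑ j ∈ Finset.range (J + 1), (-1) ^ j * ((t + 1).choose j : ℝ) = (-1) ^ J * t.choose J := by
  exact_mod_cast Int.alternating_sum_range_choose_eq_choose (n := t) (m := J)

lemma truncInversion_of_lt {N m : ℕ} (h : N < m) (J : ℕ) :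
    truncInversion (fun k => (N.descFactorial k : ℝ)) m J = 0 := by
  rw [truncInversion, Finset.sum_eq_zero, zero_div]
  intro j _
  rw [Nat.descFactorial_eq_zero_iff_lt.2 (by omega)]
  simp

lemma truncInversion_self (m J : ℕ) :
    truncInversion (fun k => (m.descFactorial k : ℝ)) m (J + 1) = 1 := by
  have := truncInversion_descFactorial_add m 0 (J + 1)
  rw [add_zero] at this
  rw [this, Finset.sum_range_succ']
  simp

/-- For N > m the truncated sum is C(N, m) times a partial alternating row sum of binomials, whose
sign is that of its last term. An even number of terms thus errs below, an odd number above. -/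
lemma truncInversion_le_indicator (N m J : ℕ) :
    truncInversion (fun k => (N.descFactorial k : ℝ)) m (2 * J) ≤ if N = m then 1 else 0 := by
  rcases J with _ | J
  · have : truncInversion (fun k => (N.descFactorial k : ℝ)) m (2 * 0) = 0 := by
      simp [truncInversion]
    rw [this]
    split_ifs <;> norm_num
  have hJ : 2 * (J + 1) = (2 * J + 1) + 1 := by ring
  rw [hJ]
  rcases lt_trichotomy N m with h | rfl | h
  · rw [truncInversion_of_lt h, if_neg h.ne]
  · rw [truncInversion_self, if_pos rfl]
  · obtain ⟨t, rfl⟩ := Nat.exists_eq_add_of_lt h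
    rw [if_neg h.ne', add_assoc, truncInversion_descFactorial_add,
      sum_range_neg_one_pow_mul_choose, pow_succ, pow_mul]
    simp only [neg_one_sq, one_pow, one_mul, neg_one_mul, mul_neg, neg_nonpos]
    positivity

lemma indicator_le_truncInversion (N m J : ℕ) :
    (if N = m then 1 else 0) ≤ truncInversion (fun k => (N.descFactorial k : ℝ)) m (2 * J + 1) := by
  rcases lt_trichotomy N m with h | rfl | h
  · rw [truncInversion_of_lt h, if_neg h.ne]
  · rw [truncInversion_self, if_pos rfl]
  · obtain ⟨t, rfl⟩ := Nat.exists_eq_add_of_lt h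
    rw [if_neg h.ne', add_assoc, truncInversion_descFactorial_add,
      sum_range_neg_one_pow_mul_choose, pow_mul]
    simp only [neg_one_sq, one_pow, one_mul]
    positivity

lemma sum_truncInversion {Ω : Type*} [Fintype Ω] (N : Ω → ℕ) (m J : ℕ) :
    truncInversion (fun k => (∑ B, ((N B).descFactorial k : ℝ)) / Fintype.card Ω) m J =
      (∑ B, truncInversion (fun k => ((N B).descFactorial k : ℝ)) m J) / Fintype.card Ω := by
  simp only [truncInversion]
  rw [← Finset.sum_div, Finset.sum_comm, div_right_comm]
  congr 1
  rw [Finset.sum_div]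
  refine Finset.sum_congr rfl fun j _ => ?_
  rw [← Finset.sum_div, ← Finset.mul_sum]
  ring

lemma sum_indicator_eq_card {Ω : Type*} [Fintype Ω] (P : Ω → Prop) [DecidablePred P] :
    ∑ B, (if P B then (1 : ℝ) else 0) = Nat.card {B // P B} := by
  rw [Finset.sum_boole, Nat.card_eq_fintype_card, Fintype.card_subtype]

lemma truncInversion_le {Ω : Type*} [Fintype Ω] (N : Ω → ℕ) (m J : ℕ) :
    truncInversion (fun k => (∑ B, ((N B).descFactorial k : ℝ)) / Fintype.card Ω) m (2 * J) ≤
      Nat.card {B // N B = m} / Fintype.card Ω := by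
  rw [sum_truncInversion, ← sum_indicator_eq_card]
  exact div_le_div_of_nonneg_right
    (Finset.sum_le_sum fun B _ => truncInversion_le_indicator _ _ _) (by positivity)

lemma le_truncInversion {Ω : Type*} [Fintype Ω] (N : Ω → ℕ) (m J : ℕ) :
    (Nat.card {B // N B = m} : ℝ) / Fintype.card Ω ≤
      truncInversion (fun k => (∑ B, ((N B).descFactorial k : ℝ)) / Fintype.card Ω) m
        (2 * J + 1) := by
  rw [sum_truncInversion, ← sum_indicator_eq_card]
  exact div_le_div_of_nonneg_right
    (Finset.sum_le_sum fun B _ => indicator_le_truncInversion _ _ _) (by positivity)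

lemma tendsto_truncInversion {M : ℕ → ℕ → ℝ} {L : ℕ → ℝ}
    (h : ∀ k, Tendsto (fun n => M n k) atTop (𝓝 (L k))) (m J : ℕ) :
    Tendsto (fun n => truncInversion (M n) m J) atTop (𝓝 (truncInversion L m J)) := by
  refine Tendsto.div_const (tendsto_finsetSum _ fun j _ => ?_) _
  exact ((h (m + j)).const_mul _).div_const _

lemma tendsto_truncInversion_pow (lam : ℝ) (m : ℕ) :
    Tendsto (fun J => truncInversion (fun k => lam ^ k) m J) atTop
      (𝓝 (Real.exp (-lam) * lam ^ m / (m !))) := by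
  have h := (NormedSpace.expSeries_div_hasSum_exp (-lam)).tendsto_sum_nat
  rw [← Real.exp_eq_exp_ℝ] at h
  refine ((h.mul_const (lam ^ m)).div_const (m ! : ℝ)).congr fun J => ?_
  rw [truncInversion, Finset.sum_mul]
  congr 1
  refine Finset.sum_congr rfl fun j _ => ?_
  rw [neg_pow]
  ring

/-- The method of factorial moments: if all factorial moments converge to those of a Poisson
variable, so do the probabilities of the single values. -/
lemma tendsto_of_factorialMoments {P : ℕ → ℝ} {M : ℕ → ℕ → ℝ} {lam : ℝ} (m : ℕ)
    (hM : ∀ k, Tendsto (fun n => M n k) atTop (𝓝 (lam ^ k)))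
    (hlow : ∀ J, ∀ᶠ n in atTop, truncInversion (M n) m (2 * J) ≤ P n)
    (hup : ∀ J, ∀ᶠ n in atTop, P n ≤ truncInversion (M n) m (2 * J + 1)) :
    Tendsto P atTop (𝓝 (Real.exp (-lam) * lam ^ m / (m !))) := by
  have h := tendsto_truncInversion_pow lam m
  -- The truncation J is fixed first, close enough to the Poisson value; only then does n grow.
  refine tendsto_order.2 ⟨fun a ha => ?_, fun a ha => ?_⟩
  · obtain ⟨J, hJ⟩ := ((h.comp (tendsto_id.const_mul_atTop' (by norm_num : 0 < 2))).eventually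
      (lt_mem_nhds ha)).exists
    filter_upwards [(tendsto_truncInversion hM m (2 * J)).eventually (lt_mem_nhds hJ), hlow J]
      with n h1 h2 using h1.trans_le h2
  · obtain ⟨J, hJ⟩ := ((h.comp ((tendsto_add_atTop_nat 1).comp
      (tendsto_id.const_mul_atTop' (by norm_num : 0 < 2)))).eventually (gt_mem_nhds ha)).exists
    filter_upwards [(tendsto_truncInversion hM m (2 * J + 1)).eventually (gt_mem_nhds hJ), hup J]
      with n h1 h2 using h2.trans_lt h1

end Bonferroni

/-! ### Convergence in distribution on the natural numbers. -/

section Distribution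

/-- In a discrete space the singletons are a π-system containing arbitrarily small neighbourhoods of
each point, so convergence on them suffices. -/
lemma tendsto_probabilityMeasure_nat {μ : ℕ → ProbabilityMeasure ℕ} {ν : ProbabilityMeasure ℕ}
    (h : ∀ m, Tendsto (fun i => (μ i : Measure ℕ).real {m}) atTop (𝓝 ((ν : Measure ℕ).real {m}))) :
    Tendsto μ atTop (𝓝 ν) := by
  refine IsPiSystem.tendsto_probabilityMeasure_of_tendsto_of_mem
    (S := Set.range fun m : ℕ => ({m} : Set ℕ)) ?_ (fun s _ => trivial) ?_ ?_
  · rintro _ ⟨a, rfl⟩ _ ⟨b, rfl⟩ ⟨x, hx, hx'⟩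
    obtain rfl : x = a := hx
    obtain rfl : x = b := hx'
    exact ⟨x, by simp⟩
  · intro u _ x hx
    exact ⟨{x}, ⟨x, rfl⟩, by simp, by simpa using hx⟩
  · rintro _ ⟨m, rfl⟩
    rw [← NNReal.tendsto_coe]
    exact h m

end Distribution

/-! ### Limits for the uniform random alternating map. -/

section Sample

variable (p n : ℕ) [Fact p.Prime]

lemma unif_real_eq (s : Set (Sample p n)) :
    (unif p n).real s = Nat.card s / Fintype.card (Sample p n) := by
  rw [measureReal_def, unif, uniformOn_univ, ENNReal.toReal_div, Nat.card_coe_set_eq,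
    Measure.count_apply_finite' (Set.toFinite s) trivial, Set.ncard_eq_toFinset_card s]
  simp

lemma integral_unif (f : Sample p n → ℝ) :
    ∫ B, f B ∂(unif p n) = (∑ B, f B) / Fintype.card (Sample p n) := by
  rw [integral_fintype (Integrable.of_finite), Finset.sum_div]
  refine Finset.sum_congr rfl fun B _ => ?_
  rw [unif_real_eq]
  simp [div_eq_inv_mul]

/-- The factorial moments of the number of totally isotropic three-dimensional subspaces. -/
noncomputable def moment (k : ℕ) : ℝ :=
  factorialMoment (ZMod p) (Fin n → ZMod p) (n - 3) k

lemma moment_eq (k : ℕ) :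
    moment p n k = (∑ B : Sample p n, ((numIsotropic B).descFactorial k : ℝ)) /
      Fintype.card (Sample p n) := by
  rw [moment, factorialMoment, Nat.card_eq_fintype_card]

variable {p n}

lemma isBad_iff (hn : 4 ≤ n) (B : Sample p n) {H : Submodule (ZMod p) (Fin n → ZMod p)}
    (hH : Module.finrank (ZMod p) H = 3) : IsBad B.1 H ↔ TotallyIsotropic B.1 H :=
  isBad_iff_totallyIsotropic (by simp; omega) (by simp; omega) hH

lemma numBad_three_eq (hn : 4 ≤ n) (B : Sample p n) : numBad p n 3 B = numIsotropic B := by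
  refine congrArg Set.ncard (Set.ext fun H => ?_)
  exact and_congr_left fun hH => isBad_iff hn B hH

lemma truncInversion_moment_le (hn : 4 ≤ n) (m J : ℕ) :
    truncInversion (moment p n) m (2 * J) ≤ (unif p n).real {B | numBad p n 3 B = m} := by
  rw [unif_real_eq, funext (moment_eq p n)]
  simp only [numBad_three_eq hn]
  exact truncInversion_le _ m J

lemma le_truncInversion_moment (hn : 4 ≤ n) (m J : ℕ) :
    (unif p n).real {B | numBad p n 3 B = m} ≤ truncInversion (moment p n) m (2 * J + 1) := by
  rw [unif_real_eq, funext (moment_eq p n)]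
  simp only [numBad_three_eq hn]
  exact le_truncInversion _ m J

lemma rate_pow_mul_le_moment {k : ℕ} (hn : 3 ≤ n) (hk : 3 * k ≤ n) :
    rate p ^ k * (1 - (p : ℝ) ^ (3 * k) / (p : ℝ) ^ n) ≤ moment p n k := by
  obtain ⟨m, rfl⟩ := Nat.exists_eq_add_of_le' hn
  have := le_factorialMoment (K := ZMod p) (V := Fin (m + 3) → ZMod p) (m := m) (k := k)
    (by simp) hk
  rwa [ZMod.card] at this

lemma moment_le {k : ℕ} (hn : 3 ≤ n) (hk : 3 * k ≤ n) :
    moment p n k ≤ rate p ^ k * (1 + ∑ d ∈ Finset.range (3 * k), eulerProd p d *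
        (p : ℝ) ^ (3 * d + 3 * d * k - d * d - 9 * k + 3 - n : ℤ)) := by
  obtain ⟨m, rfl⟩ := Nat.exists_eq_add_of_le' hn
  have := factorialMoment_le (K := ZMod p) (V := Fin (m + 3) → ZMod p) (m := m) (k := k)
    (by simp) hk
  rw [ZMod.card] at this
  refine this.trans_eq ?_
  rw [rate_eq_eulerProd]
  congr 2
  refine Finset.sum_congr rfl fun d _ => ?_
  congr 2
  push_cast
  ring

lemma two_le_cast_prime : (2 : ℝ) ≤ p := by
  exact_mod_cast (Fact.out : p.Prime).two_le

lemma tendsto_moment (p k : ℕ) [Fact p.Prime] :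
    Tendsto (fun n => moment p n k) atTop (𝓝 (rate p ^ k)) := by
  have hp := two_le_cast_prime (p := p)
  have hinv : Tendsto (fun n : ℕ => ((p : ℝ) ^ n)⁻¹) atTop (𝓝 0) :=
    (tendsto_pow_atTop_atTop_of_one_lt (by linarith)).inv_tendsto_atTop
  have hlow : Tendsto (fun n : ℕ => rate p ^ k * (1 - (p : ℝ) ^ (3 * k) / (p : ℝ) ^ n)) atTop
      (𝓝 (rate p ^ k)) := by
    have := (((hinv.const_mul ((p : ℝ) ^ (3 * k))).const_sub 1).const_mul (rate p ^ k))
    simpa [div_eq_mul_inv] using this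
  have hup : Tendsto (fun n : ℕ => rate p ^ k * (1 + ∑ d ∈ Finset.range (3 * k), eulerProd p d *
      (p : ℝ) ^ (3 * d + 3 * d * k - d * d - 9 * k + 3 - n : ℤ))) atTop (𝓝 (rate p ^ k)) := by
    have hsum : Tendsto (fun n : ℕ => ∑ d ∈ Finset.range (3 * k), eulerProd p d *
        (p : ℝ) ^ (3 * d + 3 * d * k - d * d - 9 * k + 3 - n : ℤ)) atTop
        (𝓝 (∑ d ∈ Finset.range (3 * k), 0)) := by
      refine tendsto_finsetSum _ fun d _ => ?_
      have := hinv.const_mul (eulerProd p d *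
        (p : ℝ) ^ (3 * d + 3 * d * k - d * d - 9 * k + 3 : ℤ))
      rw [mul_zero] at this
      refine this.congr fun n => ?_
      rw [zpow_sub₀ (by positivity), zpow_natCast]
      ring
    rw [Finset.sum_const_zero] at hsum
    simpa using (hsum.const_add 1).const_mul (rate p ^ k)
  refine tendsto_of_tendsto_of_tendsto_of_le_of_le' hlow hup ?_ ?_
  · filter_upwards [eventually_ge_atTop (3 * k), eventually_ge_atTop 3] with n h1 h2
      using rate_pow_mul_le_moment h2 h1
  · filter_upwards [eventually_ge_atTop (3 * k), eventually_ge_atTop 3] with n h1 h2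
      using moment_le h2 h1

lemma tendsto_prob_numBad (p m : ℕ) [Fact p.Prime] :
    Tendsto (fun n => (unif p n).real {B | numBad p n 3 B = m}) atTop
      (𝓝 (Real.exp (-rate p) * rate p ^ m / (m.factorial : ℝ))) := by
  refine tendsto_of_factorialMoments m (fun k => tendsto_moment p k) (fun J => ?_) fun J => ?_
  · filter_upwards [eventually_ge_atTop 4] with n hn using truncInversion_moment_le hn m J
  · filter_upwards [eventually_ge_atTop 4] with n hn using le_truncInversion_moment hn m J

lemma rate_pos (p : ℕ) [Fact p.Prime] : 0 < rate p :=
  eulerProd_pos (by linarith [two_le_cast_prime (p := p)]) 3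

lemma tendstoInDistribution_numBad (p : ℕ) [Fact p.Prime] :
    TendstoInDistribution (fun n : ℕ => numBad p n 3) atTop (id : ℕ → ℕ)
      (fun n : ℕ => unif p n) (poissonMeasure (rate p).toNNReal) where
  forall_aemeasurable := fun n => Measurable.of_discrete.aemeasurable
  tendsto := by
    refine tendsto_probabilityMeasure_nat fun m => ?_
    simp only [ProbabilityMeasure.coe_mk, Measure.map_id]
    rw [poissonMeasure_real_singleton, Real.coe_toNNReal _ (rate_pos p).le]
    refine (tendsto_prob_numBad p m).congr fun n => ?_
    rw [map_measureReal_apply Measurable.of_discrete (measurableSet_singleton m)]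
    rfl

lemma integral_numBadGE_le (hn : 4 ≤ n) :
    ∫ B, (numBadGE p n 4 B : ℝ) ∂(unif p n) ≤
      16 * (n - 4 : ℕ) / (p : ℝ) ^ (n - 4) := by
  obtain ⟨m, rfl⟩ := Nat.exists_eq_add_of_le' hn
  have h := sum_ncard_isBad_le (K := ZMod p) (V := Fin (m + 4) → ZMod p)
    (W := Fin (m + 4 - 3) → ZMod p) (m := m) (by simp) (by simp)
  rw [integral_unif, Nat.add_sub_cancel]
  rw [ZMod.card, ← div_le_iff₀ (card_alt_pos _), Nat.cast_sum, Nat.card_eq_fintype_card] at h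
  exact h

lemma noBad_subset (p n : ℕ) [Fact p.Prime] : noBad p n ⊆ {B | numBad p n 3 B = 0} := by
  intro B hB
  refine (Set.ncard_eq_zero (Set.toFinite _)).2 ?_
  exact Set.eq_empty_of_forall_notMem fun H hH => hB H hH.1

/-- Subspaces of dimension below 3 are never bad, so only dimension 3 and dimension at least 4
matter. -/
lemma noBad_superset (hn : 3 ≤ n) :
    {B | numBad p n 3 B = 0} ⊆ noBad p n ∪ {B | 1 ≤ numBadGE p n 4 B} := by
  intro B hB
  by_contra hcon
  simp only [Set.mem_union, not_or, Set.mem_ofPred_eq, not_le, Nat.lt_one_iff] at hcon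
  have h3 := (Set.ncard_eq_zero (Set.toFinite _)).1 hB
  have h4 := (Set.ncard_eq_zero (Set.toFinite _)).1 hcon.2
  refine hcon.1 fun H hH => ?_
  rcases lt_trichotomy (Module.finrank (ZMod p) H) 3 with h | h | h
  · exact not_isBad_of_finrank_lt (by simp; omega) h hH
  · exact Set.notMem_empty H (h3 ▸ ⟨hH, h⟩)
  · exact Set.notMem_empty H (h4 ▸ ⟨hH, h⟩)

lemma prob_numBadGE_le (p n : ℕ) [Fact p.Prime] :
    (unif p n).real {B | 1 ≤ numBadGE p n 4 B} ≤ ∫ B, (numBadGE p n 4 B : ℝ) ∂(unif p n) := by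
  classical
  rw [unif_real_eq, integral_unif]
  refine div_le_div_of_nonneg_right ?_ (by positivity)
  refine (sum_indicator_eq_card fun B => 1 ≤ numBadGE p n 4 B).symm.trans_le
    (Finset.sum_le_sum fun B _ => ?_)
  split_ifs with h
  · exact_mod_cast h
  · positivity

lemma prob_noBad_le (p n : ℕ) [Fact p.Prime] :
    (unif p n).real (noBad p n) ≤ (unif p n).real {B | numBad p n 3 B = 0} :=
  measureReal_mono (noBad_subset p n)

lemma sub_le_prob_noBad (hn : 4 ≤ n) :
    (unif p n).real {B | numBad p n 3 B = 0} - 16 * (n - 4 : ℕ) / (p : ℝ) ^ (n - 4) ≤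
      (unif p n).real (noBad p n) := by
  have h1 := (measureReal_mono (μ := unif p n) (noBad_superset (p := p) (n := n) (by omega))).trans
    (measureReal_union_le _ _)
  have h2 := (prob_numBadGE_le p n).trans (integral_numBadGE_le hn)
  linarith

lemma tendsto_large_bound (p : ℕ) [Fact p.Prime] :
    Tendsto (fun n : ℕ => 16 * (n - 4 : ℕ) / (p : ℝ) ^ (n - 4)) atTop (𝓝 0) := by
  have hp := two_le_cast_prime (p := p)
  have h := (tendsto_pow_const_div_const_pow_of_one_lt 1 (by linarith : (1 : ℝ) < p)).const_mul 16
  rw [mul_zero] at h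
  refine (h.comp (tendsto_sub_atTop_nat 4)).congr fun n => ?_
  simp [mul_div_assoc]

lemma tendsto_prob_noBad (p : ℕ) [Fact p.Prime] :
    Tendsto (fun n : ℕ => (unif p n).real (noBad p n)) atTop (𝓝 (Real.exp (-rate p))) := by
  have h0 := tendsto_prob_numBad p 0
  rw [pow_zero, mul_one, Nat.factorial_zero, Nat.cast_one, div_one] at h0
  have hlow := h0.sub (tendsto_large_bound p)
  rw [sub_zero] at hlow
  refine tendsto_of_tendsto_of_tendsto_of_le_of_le' hlow h0 ?_
    (Eventually.of_forall fun n => prob_noBad_le p n)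
  filter_upwards [eventually_ge_atTop 4] with n hn using sub_le_prob_noBad hn

lemma exists_integral_numBadGE_lt {ε : ℝ} (hε : 0 < ε) :
    ∃ C : ℕ, ∀ (p n : ℕ) [Fact p.Prime], 5 ≤ n → C ≤ max n p →
      ∫ B, (numBadGE p n 4 B : ℝ) ∂(unif p n) < ε := by
  have : Fact (Nat.Prime 2) := ⟨Nat.prime_two⟩
  obtain ⟨C₁, hC₁⟩ := eventually_atTop.1 ((tendsto_large_bound 2).eventually (gt_mem_nhds hε))
  obtain ⟨C₂, hC₂⟩ := exists_nat_gt (16 / ε)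
  refine ⟨max C₁ C₂, fun p n _ hn hC => (integral_numBadGE_le (by omega)).trans_lt ?_⟩
  have hp := two_le_cast_prime (p := p)
  -- For large n the bound is compared with that for p = 2. For large p, with n = m + 5, the
  -- inequality m + 1 ≤ p^m leaves one spare factor p, hence 16 / p.
  rcases le_max_iff.1 hC with h | h
  · refine lt_of_le_of_lt ?_ (hC₁ n ((le_max_left _ _).trans h))
    push_cast
    gcongr
  · obtain ⟨m, rfl⟩ := Nat.exists_eq_add_of_le' hn
    have hm : m + 5 - 4 = m + 1 := by omega
    have h2 : ((m + 1 : ℕ) : ℝ) ≤ (p : ℝ) ^ m := by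
      have h3 : m + 1 ≤ 2 ^ m := Nat.lt_two_pow_self
      calc ((m + 1 : ℕ) : ℝ) ≤ (2 : ℝ) ^ m := by exact_mod_cast h3
        _ ≤ (p : ℝ) ^ m := by gcongr
    have hpC : 16 / ε < p := hC₂.trans_le (by exact_mod_cast (le_max_right _ _).trans h)
    rw [div_lt_iff₀ hε] at hpC
    rw [hm, div_lt_iff₀ (by positivity), pow_succ]
    have hpos : 0 < (p : ℝ) ^ m := by positivity
    nlinarith

end Sample

/-! ### Explicit positivity of the probability of no bad subspace. -/

section Positivity

lemma mul_pow_div_le {b q : ℝ} (hb : 2 ≤ b) (hq : b ≤ q) {m₀ m : ℕ} (h1 : 1 ≤ m₀) (h : m₀ ≤ m) :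
    (m : ℝ) / q ^ m ≤ m₀ / b ^ m₀ := by
  obtain ⟨t, rfl⟩ := Nat.exists_eq_add_of_le h
  have ht : ((t + 1 : ℕ) : ℝ) ≤ 2 ^ t := by
    have : t + 1 ≤ 2 ^ t := Nat.lt_two_pow_self
    exact_mod_cast this
  have hm : ((m₀ + t : ℕ) : ℝ) ≤ m₀ * b ^ t := by
    calc ((m₀ + t : ℕ) : ℝ) ≤ m₀ * ((t + 1 : ℕ) : ℝ) := by
          have : m₀ + t ≤ m₀ * (t + 1) := by nlinarith
          exact_mod_cast this
      _ ≤ m₀ * b ^ t := by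
          gcongr
          exact ht.trans (pow_le_pow_left₀ (by norm_num) hb t)
  calc ((m₀ + t : ℕ) : ℝ) / q ^ (m₀ + t) ≤ m₀ * b ^ t / b ^ (m₀ + t) := by gcongr
    _ = m₀ / b ^ m₀ := by
        rw [pow_add]
        field_simp

lemma zpow_le_zpow_of_nonpos {b q : ℝ} (hb : 1 < b) (hq : b ≤ q) {x y : ℤ} (hxy : x ≤ y)
    (hy : y ≤ 0) : q ^ x ≤ b ^ y := by
  have h1 : q ^ x ≤ q ^ y := zpow_le_zpow_right₀ (by linarith) hxy
  refine h1.trans ?_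
  obtain ⟨k, rfl⟩ : ∃ k : ℕ, y = -(k : ℤ) := ⟨(-y).toNat, by omega⟩
  rw [zpow_neg, zpow_neg, zpow_natCast, zpow_natCast]
  gcongr

variable {p n : ℕ}

lemma one_sub_pow_div_pow_le {j l : ℕ} {b : ℝ} (hb : 1 ≤ b) (hp : b ≤ p) (h : j + l ≤ n) :
    1 - 1 / b ^ l ≤ 1 - (p : ℝ) ^ j / (p : ℝ) ^ n := by
  have hp1 : (1 : ℝ) ≤ p := hb.trans hp
  refine sub_le_sub_left ?_ 1
  rw [div_le_div_iff₀ (by positivity) (by positivity), one_mul]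
  calc (p : ℝ) ^ j * b ^ l ≤ (p : ℝ) ^ j * (p : ℝ) ^ l := by gcongr
    _ = (p : ℝ) ^ (j + l) := (pow_add _ _ _).symm
    _ ≤ (p : ℝ) ^ n := pow_le_pow_right₀ hp1 h

variable [Fact p.Prime]

/-- Completing the square in d bounds the exponent by (9/4)(k - 1)² + 3 - n. This is where the
values of c used below come from. -/
lemma moment_le_of_exponent_le {b : ℝ} {k : ℕ} {c : ℤ} (hb : 1 < b) (hp : b ≤ p)
    (hn : 3 ≤ n) (hk : 3 * k ≤ n) (hc : c ≤ 0)
    (h : ∀ d : ℤ, 3 * d + 3 * d * k - d * d - 9 * k + 3 - n ≤ c) :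
    moment p n k ≤ rate p ^ k * (1 + 3 * k * (4 * b ^ c)) := by
  have hp2 := two_le_cast_prime (p := p)
  refine (moment_le hn hk).trans ?_
  have hr := rate_pos p
  have hcard : (3 * k : ℝ) * (4 * b ^ c) = (Finset.range (3 * k)).card • (4 * b ^ c) := by
    rw [Finset.card_range, nsmul_eq_mul]
    push_cast
    ring
  rw [hcard]
  gcongr
  refine Finset.sum_le_card_nsmul _ _ _ fun d _ => ?_
  have h1 := eulerProd_le_four hp2 d
  have h2 := zpow_le_zpow_of_nonpos hb hp (h d) hc
  exact mul_le_mul h1 h2 (zpow_nonneg (by linarith) _) (by norm_num)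

lemma truncInversion_zero_four (M : ℕ → ℝ) :
    truncInversion M 0 (2 * 2) = M 0 - M 1 + M 2 / 2 - M 3 / 6 := by
  simp [truncInversion, Finset.sum_range_succ, Nat.factorial]
  ring

lemma truncInversion_zero_ten (M : ℕ → ℝ) :
    truncInversion M 0 (2 * 5) = M 0 - M 1 + M 2 / 2 - M 3 / 6 + M 4 / 24 - M 5 / 120 +
      M 6 / 720 - M 7 / 5040 + M 8 / 40320 - M 9 / 362880 := by
  simp [truncInversion, Finset.sum_range_succ, Nat.factorial]
  ring

/-- The worst rate is 64/21, at p = 2. Eight terms of the series for exp(-64/21) have a negative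
sum, so ten are used. The ninth moment sets the threshold: its exponent is at most 147 - n ≤ -13. -/
lemma prob_noBad_pos_of_dimension (hn : 160 ≤ n)
    (h : 1 / 100 < truncInversion (fun k => rate p ^ k) 0 (2 * 5) ∧ rate p ≤ 64 / 21) :
    0 < (unif p n).real (noBad p n) := by
  have hp := two_le_cast_prime (p := p)
  have h1 := truncInversion_moment_le (p := p) (show 4 ≤ n by omega) 0 5
  have h2 := sub_le_prob_noBad (p := p) (show 4 ≤ n by omega)
  have h3 : (16 : ℝ) * (n - 4 : ℕ) / (p : ℝ) ^ (n - 4) ≤ 1 / 10000 := by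
    have := mul_pow_div_le (le_refl 2) hp (show 1 ≤ 156 by norm_num) (show 156 ≤ n - 4 by omega)
    rw [mul_div_assoc]
    refine (mul_le_mul_of_nonneg_left this (by norm_num)).trans ?_
    norm_num
  have hr0 := rate_pos p
  have heven : ∀ k ≤ 8, rate p ^ k * (1 - 1 / 10 ^ 6) ≤ moment p n k := by
    intro k hk
    refine le_trans ?_ (rate_pow_mul_le_moment (by omega) (by omega))
    refine mul_le_mul_of_nonneg_left ?_ (by positivity)
    refine le_trans ?_ (one_sub_pow_div_pow_le (j := 3 * k) (l := 100) one_le_two hp (by omega))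
    norm_num
  have hodd : ∀ k ≤ 7, moment p n k ≤ rate p ^ k * (1 + 1 / 10 ^ 6) := by
    intro k hk
    refine (moment_le_of_exponent_le (c := -76) one_lt_two hp (by omega) (by omega) (by norm_num)
      fun d => ?_).trans (mul_le_mul_of_nonneg_left ?_ (by positivity))
    · interval_cases k <;> push_cast <;> nlinarith [sq_nonneg (2 * d - 3), sq_nonneg (2 * d - 6),
        sq_nonneg (2 * d - 9), sq_nonneg (2 * d - 12), sq_nonneg (2 * d - 15),
        sq_nonneg (2 * d - 18), sq_nonneg (2 * d - 21), sq_nonneg (2 * d - 24)]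
    · have : (k : ℝ) ≤ 7 := by exact_mod_cast hk
      norm_num
      linarith
  have hnine : moment p n 9 ≤ rate p ^ 9 * (1 + 1 / 50) := by
    refine (moment_le_of_exponent_le (c := -13) one_lt_two hp (by omega) (by omega) (by norm_num)
      fun d => ?_).trans (mul_le_mul_of_nonneg_left ?_ (by positivity))
    · push_cast
      nlinarith [sq_nonneg (d - 15)]
    · norm_num
  rw [truncInversion_zero_ten] at h h1
  have hpow : ∀ k, rate p ^ k ≤ (64 / 21) ^ k := fun k => pow_le_pow_left₀ hr0.le h.2 k
  have := heven 0 (by norm_num)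
  have := heven 2 (by norm_num)
  have := heven 4 (by norm_num)
  have := heven 6 (by norm_num)
  have := heven 8 (by norm_num)
  have := hodd 1 (by norm_num)
  have := hodd 3 (by norm_num)
  have := hodd 5 (by norm_num)
  have := hodd 7 (by norm_num)
  have := hpow 0
  have := hpow 1
  have := hpow 2
  have := hpow 3
  have := hpow 4
  have := hpow 5
  have := hpow 6
  have := hpow 7
  have := hpow 8
  have := hpow 9
  norm_num at *
  linarith

lemma prob_noBad_pos_of_prime (hp : 13 ≤ p) (hn : 12 ≤ n) :
    0 < (unif p n).real (noBad p n) := by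
  have hp' : (13 : ℝ) ≤ p := by exact_mod_cast hp
  have h1 := truncInversion_moment_le (p := p) (show 4 ≤ n by omega) 0 2
  have h2 := sub_le_prob_noBad (p := p) (show 4 ≤ n by omega)
  have h3 : (16 : ℝ) * (n - 4 : ℕ) / (p : ℝ) ^ (n - 4) ≤ 1 / 10000 := by
    have := mul_pow_div_le (by norm_num) hp' (show 1 ≤ 8 by norm_num) (show 8 ≤ n - 4 by omega)
    rw [mul_div_assoc]
    refine (mul_le_mul_of_nonneg_left this (by norm_num)).trans ?_
    norm_num
  have hr1 : 1 ≤ rate p := one_le_eulerProd (by linarith) 3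
  have hr2 : rate p ≤ 1.0903 := by
    refine (eulerProd_le_of_le (by norm_num) hp' 3).trans ?_
    norm_num [eulerProd, Finset.prod_Icc_succ_top]
  have hM0 : 1 - 1 / 10000 ≤ moment p n 0 := by
    have := rate_pow_mul_le_moment (p := p) (n := n) (k := 0) (by omega) (by omega)
    refine le_trans ?_ this
    rw [pow_zero, one_mul]
    refine le_trans ?_ (one_sub_pow_div_pow_le (j := 3 * 0) (l := 6) (by norm_num) hp' (by omega))
    norm_num
  have hM1 : moment p n 1 ≤ rate p + 1 / 10000 := by
    refine (moment_le_of_exponent_le (c := -9) (by norm_num) hp' (by omega) (by omega)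
      (by norm_num) fun d => ?_).trans ?_
    · push_cast
      nlinarith [sq_nonneg (d - 3)]
    · norm_num
      linarith
  have hM2 : rate p ^ 2 - 1 / 1000 ≤ moment p n 2 := by
    refine le_trans ?_ (rate_pow_mul_le_moment (by omega) (by omega))
    have := one_sub_pow_div_pow_le (n := n) (j := 3 * 2) (l := 6) (by norm_num) hp' (by omega)
    have h4 : 1 - 1 / 10000 ≤ 1 - (p : ℝ) ^ (3 * 2) / (p : ℝ) ^ n := le_trans (by norm_num) this
    nlinarith
  have hM3 : moment p n 3 ≤ rate p ^ 3 * 2.2584 := by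
    refine (moment_le (by omega) (by omega)).trans (mul_le_mul_of_nonneg_left ?_ (by positivity))
    -- For k = 3 the exponent equals -(d - 6)² + 12 - n, which is where n ≥ 12 enters. The d = 6
    -- term need not be small, so the terms are summed individually.
    have hsum : ∀ d ∈ Finset.range (3 * 3), eulerProd p d *
        (p : ℝ) ^ (3 * d + 3 * d * (3 : ℕ) - d * d - 9 * (3 : ℕ) + 3 - n : ℤ) ≤
        1.0904 * (13 : ℝ) ^ (-((d - 6) * (d - 6)) : ℤ) := by
      intro d hd
      have hd := Finset.mem_range.1 hd
      refine mul_le_mul ?_ (zpow_le_zpow_of_nonpos (by norm_num) hp' ?_ ?_)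
        (zpow_nonneg (by linarith) _) (by norm_num)
      · refine (eulerProd_mono (by linarith) (show d ≤ 8 by omega)).trans
          ((eulerProd_le_of_le (by norm_num) hp' 8).trans ?_)
        norm_num [eulerProd, Finset.prod_Icc_succ_top]
      · push_cast
        nlinarith
      · nlinarith [mul_self_nonneg ((d : ℤ) - 6)]
    have := Finset.sum_le_sum hsum
    refine (add_le_add_right this 1).trans ?_
    norm_num [Finset.sum_range_succ]
  rw [truncInversion_zero_four] at h1
  -- This is f(1.0903) - f(`rate p`) for f(x) = x - x²/2 + (2.2584/6)x³, so the lower bound for the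
  -- truncated sum is worst at the numerical upper bound 1.0903 of the rate.
  have key : 0 ≤ (1.0903 - rate p) * (1 - (rate p + 1.0903) / 2 +
      2.2584 / 6 * (rate p ^ 2 + 1.0903 * rate p + 1.0903 ^ 2)) :=
    mul_nonneg (by linarith) (by nlinarith)
  nlinarith

lemma prob_noBad_pos (p n : ℕ) [Fact p.Prime] (h : 12 ≤ min p n ∨ 160 ≤ n) :
    0 < (unif p n).real (noBad p n) := by
  have hprime : p.Prime := Fact.out
  rcases le_or_gt 13 p with hp | hp
  · refine prob_noBad_pos_of_prime hp ?_
    rcases h with h | h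
    · exact h.trans (min_le_right _ _)
    · omega
  -- As 12 is not prime, `12 ≤ min p n` gives p ≥ 13; below 13 only the case n ≥ 160 is left, and
  -- the primes are checked one by one.
  · have hp12 : p ≠ 12 := by
      rintro rfl
      norm_num at hprime
    have hn : 160 ≤ n := by
      rcases h with h | h
      · have := h.trans (min_le_left _ _)
        omega
      · exact h
    refine prob_noBad_pos_of_dimension hn ?_
    rw [truncInversion_zero_ten]
    interval_cases p <;>
      first
      | (exfalso; revert hprime; norm_num; done)
      | norm_num [rate, Finset.prod_Icc_succ_top]

end Positivity

end BadSubspaces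

theorem proposition4p1 :
    -- (1) the expected number of bad subspaces of dimension at least 4 tends to 0
    -- as max (n, p) tends to infinity
    (∀ ε : ℝ, 0 < ε → ∃ C : ℕ, ∀ (p n : ℕ) [Fact p.Prime], 5 ≤ n → C ≤ max n p →
      ∫ B, (BadSubspaces.numBadGE p n 4 B : ℝ) ∂(BadSubspaces.unif p n) < ε) ∧
    -- (2) a 3-dimensional subspace is bad iff it is totally isotropic, and the number of these
    -- converges in distribution to a Poisson variable as n tends to infinity
    ((∀ (p n : ℕ) [Fact p.Prime], 5 ≤ n → ∀ (B : BadSubspaces.Sample p n)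
        (H : Submodule (ZMod p) (Fin n → ZMod p)), Module.finrank (ZMod p) H = 3 →
          (BadSubspaces.IsBad B.1 H ↔ BadSubspaces.TotallyIsotropic B.1 H)) ∧
      (∀ (p : ℕ) [Fact p.Prime],
        TendstoInDistribution (fun n : ℕ => BadSubspaces.numBad p n 3) atTop (id : ℕ → ℕ)
          (fun n : ℕ => BadSubspaces.unif p n)
          (poissonMeasure (BadSubspaces.rate p).toNNReal))) ∧
    -- (3) the probability that there is no bad subspace
    ((∀ (p n : ℕ) [Fact p.Prime], 12 ≤ min p n ∨ 160 ≤ n →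
        0 < (BadSubspaces.unif p n).real (BadSubspaces.noBad p n)) ∧
      (∀ (p : ℕ) [Fact p.Prime],
        Tendsto (fun n : ℕ => (BadSubspaces.unif p n).real (BadSubspaces.noBad p n)) atTop
          (𝓝 (Real.exp (-BadSubspaces.rate p))))) := by
  refine ⟨fun ε hε => BadSubspaces.exists_integral_numBadGE_lt hε,
    ⟨fun p n _ hn B H hH => BadSubspaces.isBad_iff (by omega) B hH,
      fun p _ => BadSubspaces.tendstoInDistribution_numBad p⟩,
    fun p n _ h => BadSubspaces.prob_noBad_pos p n h,
    fun p _ => BadSubspaces.tendsto_prob_noBad p⟩
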